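/- Let $n\ge 2$, and let $\tilde S_n$ be the affine symmetric group: the group, under composition, of all bijections $w:\mathbb Z\to\mathbb Z$ with $w(i+n)=w(i)+n$ for all $i$ and $\sum_{i=1}^n w(i)=\sum_{i=1}^n i$. For integers $r\not\equiv s \pmod n$ let $t_{r,s}\in\tilde S_n$ be the element with $t_{r,s}(r)=s$, $t_{r,s}(s)=r$ and $t_{r,s}(i)=i$ for all $i$ congruent to neither $r$ nor $s$ modulo $n$. Put $s_i=t_{i,i+1}$ for $i\in\mathbb Z/n\mathbb Z$, and let $\ell(w)$ be the minimal length of a word $a_1\cdots a_l$ in the alphabet $\mathbb Z/n\mathbb Z$ with $w=s_{a_1}\cdots s_{a_l}$; words attaining the minimum are the reduced words of $w$. Write $v\lessdot w$ if $w=vt_{r,s}$ for some $r,s$ and $\ell(w)=\ell(v)+1$. For $r\in\mathbb Z$ and $v\in\tilde S_n$ put \[\Psi_r^+(v)=\{w : v\lessdot w,\ w=vt_{r,s}\text{ for some } s>r\},\qquad \Psi_r^-(v)=\{w : v\lessdot w,\ w=vt_{s,r}\text{ for some } s<r\}\] (the right and the left $r$-covers of $v$). A reduced word is cyclically decreasing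 if its letters are distinct and, whenever $i$ and $i+1$ (modulo $n$) both occur in it, $i+1$ occurs before $i$. An element of $\tilde S_n$ is cyclically decreasing if it has a cyclically decreasing reduced word. For a sequence $\alpha=(\alpha_1,\alpha_2,\dots)$ of nonnegative integers, all but finitely many zero, with $\sum_i\alpha_i=\ell(w)$, an $\alpha$-decomposition of $w$ is a sequence $(w^1,w^2,\dots)$ of cyclically decreasing elements with $\ell(w^i)=\alpha_i$ for all $i$ (so $w^i=1$ for all large $i$) and $w=w^1w^2\cdots$. The affine Stanley symmetric function of $w$ is the formal power series \[\tilde F_w=\sum_{\alpha}(\text{number of }\alpha\text{-decompositions of }w)\,x^\alpha\] in $x_1,x_2,\dots$, the sum being over all such $\alpha$. Theorem (affine Garsia–Little formula). For every $r\in\mathbb Z$ and $v\in\tilde S_n$ the sets $\Psi_r^-(v)$ and $\Psi_r^+(v)$ are finite and \[\sum_{u\in\Psi_r^-(v)}\tilde F_u=\sum_{w\in\Psi_r^+(v)}\tilde F_w.\] -/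

import Mathlib

namespace AffineStanley

/-- Reindexing the window by a quasi-periodic bijection does not change the sum of an `n`-periodic
function. -/
theorem sum_window_comp (n : ℕ) (u : Equiv.Perm ℤ) (hu : ∀ i, u (i + n) = u i + n)
    (g : ℤ → ℤ) (hg : ∀ i, g (i + n) = g i) :
    ∑ i ∈ Finset.Icc (1 : ℤ) n, g (u i) = ∑ i ∈ Finset.Icc (1 : ℤ) n, g i := by
  rcases Nat.eq_zero_or_pos n with rfl | hn
  · simp
  have hn' : (0 : ℤ) < n := by exact_mod_cast hn
  have hgk : ∀ (k i : ℤ), g (i + k * n) = g i := by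
    intro k
    induction k using Int.induction_on with
    | zero => intro i; simp
    | succ k ih => intro i; rw [← ih i, ← hg (i + k * n)]; congr 1; ring
    | pred k ih => intro i; rw [← ih i, ← hg (i + (-(k : ℤ) - 1) * n)]; congr 1; ring
  have huk : ∀ (k i : ℤ), u (i + k * n) = u i + k * n := by
    intro k
    induction k using Int.induction_on with
    | zero => intro i; simp
    | succ k ih =>
      intro i
      have := hu (i + k * n)
      rw [ih i] at this
      rw [show i + ((k : ℤ) + 1) * n = i + k * n + n by ring, this]; ring
    | pred k ih =>
      intro i
      have := hu (i + (-(k : ℤ) - 1) * n)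
      rw [show i + (-(k : ℤ) - 1) * n + n = i + -(k : ℤ) * n by ring, ih i] at this
      linarith
  set m : ℤ → ℤ := fun i => (u i - 1) % n + 1 with hm
  have hmaps : ∀ i, m i ∈ Finset.Icc (1 : ℤ) n := by
    intro i
    have h1 := Int.emod_nonneg (u i - 1) hn'.ne'
    have h2 := Int.emod_lt_of_pos (u i - 1) hn'
    simp only [hm, Finset.mem_Icc]
    omega
  have hinj : Set.InjOn m (Finset.Icc (1 : ℤ) n) := by
    intro i hi j hj hij
    simp only [Finset.coe_Icc, Set.mem_Icc] at hi hj
    have h1 : (u i - 1) % n = (u j - 1) % n := by simpa [hm] using hij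
    obtain ⟨k, hk⟩ : (n : ℤ) ∣ (u j - 1) - (u i - 1) := Int.ModEq.dvd h1
    have h2 : u j = u (i + k * n) := by rw [huk]; linarith
    have h3 := u.injective h2
    have h4 : k < 1 := by nlinarith
    have h5 : -1 < k := by nlinarith
    have h6 : k = 0 := by omega
    subst h6
    simpa using h3.symm
  have himg : (Finset.Icc (1 : ℤ) n).image m = Finset.Icc (1 : ℤ) n := by
    apply Finset.eq_of_subset_of_card_le
    · intro x hx
      obtain ⟨i, -, rfl⟩ := Finset.mem_image.1 hx
      exact hmaps i
    · rw [Finset.card_image_of_injOn hinj]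
  conv_rhs => rw [← himg, Finset.sum_image hinj]
  refine Finset.sum_congr rfl fun i _ => ?_
  rw [← hgk (-((u i - 1) / n)) (u i)]
  congr 1
  simp only [hm]
  have := Int.emod_add_mul_ediv (u i - 1) n
  linarith

/-- The affine symmetric group: bijections `w : ℤ → ℤ` with `w (i + n) = w i + n` and
`w 1 + ⋯ + w n = 1 + ⋯ + n`, under composition. -/
def affineSymmetricGroup (n : ℕ) : Subgroup (Equiv.Perm ℤ) where
  carrier := {w | (∀ i, w (i + n) = w i + n) ∧
    ∑ i ∈ Finset.Icc (1 : ℤ) n, w i = ∑ i ∈ Finset.Icc (1 : ℤ) n, i}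
  one_mem' := by simp
  mul_mem' := by
    rintro u w ⟨hu, hus⟩ ⟨hw, hws⟩
    refine ⟨fun i => by simp [hw, hu], ?_⟩
    have h := sum_window_comp n w hw (fun i => u i - i) (fun i => by simp [hu])
    simp only [Finset.sum_sub_distrib] at h
    simp only [Equiv.Perm.mul_apply]
    linarith
  inv_mem' := by
    rintro u ⟨hu, hus⟩
    have hi : ∀ i, u⁻¹ (i + n) = u⁻¹ i + n := fun i => by
      rw [Equiv.Perm.inv_eq_iff_eq, hu]; simp
    refine ⟨hi, ?_⟩
    have h := sum_window_comp n u hu (fun i => u⁻¹ i - i) (fun i => by simp [hi])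
    simp only [Finset.sum_sub_distrib] at h
    have hc : ∀ x, u⁻¹ (u x) = x := fun x => u.symm_apply_apply x
    simp only [hc] at h
    linarith

/-- The function exchanging `r + k n` and `s + k n` for all `k`, and fixing all other integers
(for `r`, `s` incongruent modulo `n`). -/
def transpositionFun (n : ℕ) (r s i : ℤ) : ℤ :=
  if i ≡ r [ZMOD n] then i + (s - r) else if i ≡ s [ZMOD n] then i + (r - s) else i

theorem transpositionFun_involutive {n : ℕ} {r s : ℤ} (h : ¬ r ≡ s [ZMOD n]) :
    Function.Involutive (transpositionFun n r s) := by
  intro i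
  unfold transpositionFun
  by_cases h1 : i ≡ r [ZMOD n]
  · have h2 : i + (s - r) ≡ s [ZMOD n] := by
      have := h1.add_right (s - r)
      rwa [show r + (s - r) = s by ring] at this
    have h3 : ¬ i + (s - r) ≡ r [ZMOD n] := fun h' => h (h'.symm.trans h2)
    simp only [h1, h2, h3, if_true, if_false]
    ring
  · by_cases h2 : i ≡ s [ZMOD n]
    · have h3 : i + (r - s) ≡ r [ZMOD n] := by
        have := h2.add_right (r - s)
        rwa [show s + (r - s) = r by ring] at this
      simp only [h1, h2, h3, if_true, if_false]
      ring
    · simp [h1, h2]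

theorem transpositionFun_add (n : ℕ) (r s i : ℤ) :
    transpositionFun n r s (i + n) = transpositionFun n r s i + n := by
  unfold transpositionFun
  have e : ∀ t, (i + n ≡ t [ZMOD n]) ↔ (i ≡ t [ZMOD n]) := fun t => by simp [Int.ModEq]
  simp only [e]
  split_ifs <;> ring

/-- The affine transposition `t_{r,s}`, for `r`, `s` incongruent modulo `n`: the element of the
affine symmetric group with `r ↦ s`, `s ↦ r` fixing every `i` congruent to neither. -/
def transposition (n : ℕ) (r s : ℤ) (h : ¬ r ≡ s [ZMOD n]) : affineSymmetricGroup n :=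
  ⟨(transpositionFun_involutive h).toPerm, fun i => transpositionFun_add n r s i, by
    have hs := sum_window_comp n (transpositionFun_involutive h).toPerm
      (fun i => transpositionFun_add n r s i) (fun i => transpositionFun n r s i - i)
      (fun i => by simp [transpositionFun_add])
    simp only [Function.Involutive.coe_toPerm, transpositionFun_involutive h _,
      Finset.sum_sub_distrib] at hs ⊢
    linarith⟩

/-- The simple reflection `s_i = t_{i,i+1}`, `i ∈ ℤ/nℤ` (computed from the representative of `i`
in `0, …, n - 1`; it does not depend on the representative). Only used for `2 ≤ n`; the value is
set to `1` if `i` and `i + 1` are congruent, that is, if `n = 1`. -/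
def simpleReflection (n : ℕ) (i : ZMod n) : affineSymmetricGroup n :=
  if h : ¬ (i.val : ℤ) ≡ i.val + 1 [ZMOD n] then transposition n i.val (i.val + 1) h else 1

/-- The product `s_{a_1} ⋯ s_{a_l}` of a word `a_1 ⋯ a_l` in the alphabet `ℤ/nℤ`. -/
def wordProd (n : ℕ) (a : List (ZMod n)) : affineSymmetricGroup n :=
  (a.map (simpleReflection n)).prod

/-- The length of `w`: the least length of a word with product `w`. -/
noncomputable def length {n : ℕ} (w : affineSymmetricGroup n) : ℕ :=
  sInf {l | ∃ a : List (ZMod n), a.length = l ∧ wordProd n a = w}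

/-- `a` is a reduced word for `w`. -/
def IsReducedWord {n : ℕ} (a : List (ZMod n)) (w : affineSymmetricGroup n) : Prop :=
  wordProd n a = w ∧ a.length = length w

/-- The covering relation `v ⋖ w` of the strong Bruhat order. -/
def StrongCover {n : ℕ} (v w : affineSymmetricGroup n) : Prop :=
  (∃ (r s : ℤ) (h : ¬ r ≡ s [ZMOD n]), w = v * transposition n r s h) ∧ length w = length v + 1

/-- The set of right `r`-covers of `v`: the `w ⋗ v` with `w = v t_{r,s}` for some `s > r`. -/
def rightCovers {n : ℕ} (r : ℤ) (v : affineSymmetricGroup n) : Set (affineSymmetricGroup n) :=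
  {w | StrongCover v w ∧
    ∃ (s : ℤ) (h : ¬ r ≡ s [ZMOD n]), r < s ∧ w = v * transposition n r s h}

/-- The set of left `r`-covers of `v`: the `w ⋗ v` with `w = v t_{s,r}` for some `s < r`. -/
def leftCovers {n : ℕ} (r : ℤ) (v : affineSymmetricGroup n) : Set (affineSymmetricGroup n) :=
  {w | StrongCover v w ∧
    ∃ (s : ℤ) (h : ¬ s ≡ r [ZMOD n]), s < r ∧ w = v * transposition n s r h}

/-- A word is cyclically decreasing if it is reduced, has no repeated letter, and `i + 1` occurs
before `i` whenever both occur (letters are taken modulo `n`). -/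
def IsCyclicallyDecreasingWord {n : ℕ} (a : List (ZMod n)) : Prop :=
  IsReducedWord a (wordProd n a) ∧ a.Nodup ∧
    ∀ i, i ∈ a → i + 1 ∈ a → a.idxOf (i + 1) < a.idxOf i

/-- `w` is cyclically decreasing if it has a cyclically decreasing reduced word. -/
def IsCyclicallyDecreasing {n : ℕ} (w : affineSymmetricGroup n) : Prop :=
  ∃ a : List (ZMod n), IsReducedWord a w ∧ IsCyclicallyDecreasingWord a

/-- The `α`-decompositions of `w`, for a composition `α = (α_0, α_1, …)` of `length w` (zero parts
allowed, all but finitely many parts zero): sequences of cyclically decreasing elements `f i` of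
length `α i`, all but finitely many equal to `1`, with ordered product `f 0 * f 1 * ⋯ = w`. The
set is empty if the parts of `α` do not sum to `length w`. -/
def decompositions {n : ℕ} (w : affineSymmetricGroup n) (α : ℕ →₀ ℕ) :
    Set (ℕ → affineSymmetricGroup n) :=
  {f | α.degree = length w ∧ (∀ i, IsCyclicallyDecreasing (f i) ∧ length (f i) = α i) ∧
    ∃ N : ℕ, (∀ i, N ≤ i → f i = 1) ∧ ((List.range N).map f).prod = w}

theorem decompositions_finite {n : ℕ} (hn : n ≠ 0) (w : affineSymmetricGroup n) (α : ℕ →₀ ℕ) :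
    (decompositions w α).Finite := by
  have : NeZero n := ⟨hn⟩
  have hT : ∀ k : ℕ, ((wordProd n) '' {a | a.length = k}).Finite := fun k =>
    (List.finite_length_eq (ZMod n) k).image _
  obtain ⟨M, hM⟩ : ∃ M : ℕ, ∀ i, M ≤ i → α i = 0 := by
    refine ⟨α.support.sup id + 1, fun i hi => ?_⟩
    by_contra h
    have : i ≤ α.support.sup id := Finset.le_sup (f := id) (Finsupp.mem_support_iff.2 h)
    omega
  have hmem : ∀ f ∈ decompositions w α, ∀ i,
      f i ∈ (wordProd n) '' {a | a.length = α i} := by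
    rintro f ⟨-, hf, -⟩ i
    obtain ⟨⟨a, ha, -⟩, hl⟩ := hf i
    exact ⟨a, ha.2.trans hl, ha.1⟩
  refine Set.Finite.of_finite_image (f := fun f (i : Fin M) => f i) ?_ ?_
  · refine (Set.Finite.pi' (fun i : Fin M => hT (α i))).subset ?_
    rintro _ ⟨f, hf, rfl⟩ i
    exact hmem f hf i
  · intro f hf g hg hfg
    funext i
    by_cases hi : i < M
    · exact congrFun hfg ⟨i, hi⟩
    · obtain ⟨a, ha, hfa⟩ := hmem f hf i
      obtain ⟨b, hb, hgb⟩ := hmem g hg i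
      rw [Set.mem_ofPred_eq, hM i (by omega), List.length_eq_zero_iff] at ha hb
      rw [← hfa, ← hgb, ha, hb]

/-- The affine Stanley symmetric function of `w`, a formal power series in `x_0, x_1, …` with
integer coefficients: the coefficient of `x^α` is the number of `α`-decompositions of `w`. -/
noncomputable def affineStanley {n : ℕ} (w : affineSymmetricGroup n) : MvPowerSeries ℕ ℤ :=
  fun α => ((decompositions w α).ncard : ℤ)

end AffineStanley

namespace AffineStanley

set_option linter.unusedSectionVars false

/-! ### Periodicity of affine permutations and conjugation of transpositions. -/

section Action

variable {n : ℕ}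

/-! Right and left `r`-covers are counted with signs `1` and `-1`: for a function `f` on the group
put `(D_r f)(v) = ∑ ± f(w)` over the `r`-covers `w` of `v` (`coverSum`). For fixed `α`, let `f(w)`
be the coefficient of `x^α` in the affine Stanley function of `w`. The formula says that `D_r f = 0`
for every `r` and `α`.

Such an `f` is built from the indicator of the identity by repeated right multiplication, in the
affine nilCoxeter algebra, by `h_k`, the sum of the cyclically decreasing elements of length `k`
(`homMul`, `factorCount`). Covers have positive length, so `D_r` kills the indicator. It remains to
show that multiplication by `h_k` preserves the common kernel of all the `D_r`.

For a generator, the lifting property of Bruhat order gives a Leibniz rule `D_r T_i = T_i D_{s_i r}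
+ sign(s_i r - r)` (`coverSum_nilMul_simpleReflection`). Building a cyclically decreasing element
`cyc I` one letter at a time gives `D_r T_{cyc I} = T_{cyc I} D_{cyc I (r)} + ∑_{j ∈ I} c(I \ {j},
j) T_{cyc (I \ {j})}`, where `c(J, j) = [cyc J (r) ≡ j] - [r - 1 ≡ j]` (`coverSum_nilMul_cyc`). Sum
over `|I| = k` and collect the terms with `J = I \ {j}`: their coefficient is the sum of `c(J, j)`
over `j ∉ J`. It vanishes, because `cyc J (r)` and `r - 1` are either both in `J` modulo `n` or both
outside it (`sum_insertSign`). -/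

theorem apply_add_mul (u : affineSymmetricGroup n) (k x : ℤ) :
    u.1 (x + k * n) = u.1 x + k * n := by
  induction k using Int.induction_on with
  | zero => simp
  | succ k ih =>
    have := u.2.1 (x + k * n)
    rw [ih] at this
    rw [show x + ((k : ℤ) + 1) * n = x + k * n + n by ring, this]; ring
  | pred k ih =>
    have := u.2.1 (x + (-(k : ℤ) - 1) * n)
    rw [show x + (-(k : ℤ) - 1) * n + n = x + -(k : ℤ) * n by ring, ih] at this
    linarith

theorem apply_modEq_iff (u : affineSymmetricGroup n) (x y : ℤ) :
    u.1 x ≡ u.1 y [ZMOD n] ↔ x ≡ y [ZMOD n] := by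
  have key : ∀ (w : affineSymmetricGroup n) (x y : ℤ),
      x ≡ y [ZMOD n] → w.1 x ≡ w.1 y [ZMOD n] := by
    intro w x y h
    obtain ⟨k, hk⟩ := h.dvd
    rw [show y = x + k * n by linarith, apply_add_mul]
    simp [Int.ModEq]
  refine ⟨fun h => ?_, key u x y⟩
  have := key u⁻¹ _ _ h
  simpa using this

theorem transposition_apply {r s : ℤ} (h : ¬ r ≡ s [ZMOD n]) (x : ℤ) :
    (transposition n r s h).1 x = transpositionFun n r s x := rfl

theorem transposition_apply_left {r s : ℤ} (h : ¬ r ≡ s [ZMOD n]) :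
    (transposition n r s h).1 r = s := by
  simp [transposition_apply, transpositionFun]

theorem transposition_apply_right {r s : ℤ} (h : ¬ r ≡ s [ZMOD n]) :
    (transposition n r s h).1 s = r := by
  have : ¬ s ≡ r [ZMOD n] := fun h' => h h'.symm
  simp [transposition_apply, transpositionFun, this]

theorem transposition_mul_self {r s : ℤ} (h : ¬ r ≡ s [ZMOD n]) :
    transposition n r s h * transposition n r s h = 1 := by
  apply Subtype.ext; ext x
  exact transpositionFun_involutive h x

theorem transposition_comm {r s : ℤ} (h : ¬ r ≡ s [ZMOD n]) (h' : ¬ s ≡ r [ZMOD n]) :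
    transposition n s r h' = transposition n r s h := by
  apply Subtype.ext; ext x
  change transpositionFun n s r x = transpositionFun n r s x
  unfold transpositionFun
  by_cases h1 : x ≡ r [ZMOD n]
  · have : ¬ x ≡ s [ZMOD n] := fun h2 => h (h1.symm.trans h2)
    simp [h1, this]
  · simp [h1]

theorem mul_transposition (u : affineSymmetricGroup n) {r s : ℤ} (h : ¬ r ≡ s [ZMOD n])
    (h' : ¬ u.1 r ≡ u.1 s [ZMOD n]) :
    u * transposition n r s h = transposition n (u.1 r) (u.1 s) h' * u := by
  apply Subtype.ext; ext x
  change u.1 (transpositionFun n r s x) = transpositionFun n (u.1 r) (u.1 s) (u.1 x)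
  unfold transpositionFun
  simp only [apply_modEq_iff]
  split_ifs with h1 h2
  · obtain ⟨k, hk⟩ := h1.symm.dvd
    rw [show x + (s - r) = s + k * n by linarith, show x = r + k * n by linarith]
    simp only [apply_add_mul]; ring
  · obtain ⟨k, hk⟩ := h2.symm.dvd
    rw [show x + (r - s) = r + k * n by linarith, show x = s + k * n by linarith]
    simp only [apply_add_mul]; ring
  · rfl

/-- A transposition moving `r` is determined by the image of `r`. -/
theorem transposition_eq_of_apply_ne {a b : ℤ} (h : ¬ a ≡ b [ZMOD n]) {r : ℤ}
    (hr : (transposition n a b h).1 r ≠ r) :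
    ∃ h' : ¬ r ≡ (transposition n a b h).1 r [ZMOD n],
      transposition n a b h = transposition n r ((transposition n a b h).1 r) h' := by
  -- Only integers congruent to `a` or `b` are moved, so the pair can be shifted by a multiple of
  -- `n` until one entry is `r`.
  obtain ⟨k, hk⟩ : ∃ k : ℤ, r = a + k * n ∨ r = b + k * n := by
    by_contra! hcon
    apply hr
    have h1 : ¬ r ≡ a [ZMOD n] := fun h' => by
      obtain ⟨k, hk⟩ := h'.symm.dvd
      exact (hcon k).1 (by linarith)
    have h2 : ¬ r ≡ b [ZMOD n] := fun h' => by
      obtain ⟨k, hk⟩ := h'.symm.dvd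
      exact (hcon k).2 (by linarith)
    simp [transposition_apply, transpositionFun, h1, h2]
  have e : ∀ x y : ℤ, x ≡ y + k * n [ZMOD n] ↔ x ≡ y [ZMOD n] := by
    intro x y; simp [Int.ModEq]
  have e' : ∀ x y : ℤ, y + k * n ≡ x [ZMOD n] ↔ y ≡ x [ZMOD n] := by
    intro x y; simp [Int.ModEq]
  rcases hk with rfl | rfl
  · have h2 : (transposition n a b h).1 (a + k * n) = b + k * n := by
      rw [apply_add_mul, transposition_apply_left]
    have h3 : ¬ a + k * n ≡ (transposition n a b h).1 (a + k * n) [ZMOD n] := by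
      rw [h2, e, e']; exact h
    refine ⟨h3, ?_⟩
    apply Subtype.ext; ext x
    change transpositionFun n a b x = transpositionFun n _ _ x
    rw [h2]
    simp only [transpositionFun, e]
    split_ifs <;> ring
  · have hc : ¬ b ≡ a [ZMOD n] := fun h' => h h'.symm
    have h2 : (transposition n a b h).1 (b + k * n) = a + k * n := by
      rw [apply_add_mul, transposition_apply_right]
    have h3 : ¬ b + k * n ≡ (transposition n a b h).1 (b + k * n) [ZMOD n] := by
      rw [h2, e, e']; exact hc
    refine ⟨h3, ?_⟩
    apply Subtype.ext; ext x
    rw [transposition_apply, transposition_apply, h2, ← transposition_apply h,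
      ← transposition_comm h hc, transposition_apply]
    simp only [transpositionFun, e]
    split_ifs <;> ring

end Action

/-! ### Simple reflections generate the group. -/

section Simple

variable {n : ℕ} [NeZero n] [Fact (1 < n)]

theorem modEq_val_iff (x : ℤ) (i : ZMod n) : x ≡ i.val [ZMOD n] ↔ (x : ZMod n) = i := by
  rw [← ZMod.intCast_eq_intCast_iff]; simp

theorem not_modEq_add_one (x : ℤ) : ¬ x ≡ x + 1 [ZMOD n] := by
  rw [← ZMod.intCast_eq_intCast_iff]; simp

theorem simpleReflection_apply (i : ZMod n) (x : ℤ) :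
    (simpleReflection n i).1 x =
      if (x : ZMod n) = i then x + 1 else if (x : ZMod n) = i + 1 then x - 1 else x := by
  have h2 : x ≡ i.val + 1 [ZMOD n] ↔ (x : ZMod n) = i + 1 := by
    rw [← ZMod.intCast_eq_intCast_iff]; simp
  rw [simpleReflection, dif_pos (not_modEq_add_one _), transposition_apply, transpositionFun]
  simp only [modEq_val_iff, h2]
  split_ifs <;> ring

theorem simpleReflection_mul_self (i : ZMod n) :
    simpleReflection n i * simpleReflection n i = 1 := by
  rw [simpleReflection, dif_pos (not_modEq_add_one _), transposition_mul_self]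

theorem simpleReflection_inv (i : ZMod n) :
    (simpleReflection n i)⁻¹ = simpleReflection n i :=
  inv_eq_of_mul_eq_one_left (simpleReflection_mul_self i)

theorem mul_simpleReflection_cancel (w : affineSymmetricGroup n) (i : ZMod n) :
    w * simpleReflection n i * simpleReflection n i = w := by
  rw [mul_assoc, simpleReflection_mul_self, mul_one]

theorem simpleReflection_simpleReflection_apply (i : ZMod n) (x : ℤ) :
    (simpleReflection n i).1 ((simpleReflection n i).1 x) = x := by
  have := congrArg (fun w : affineSymmetricGroup n => w.1 x) (simpleReflection_mul_self i)
  simpa using this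

theorem transposition_add_one (x : ℤ) (h : ¬ x ≡ x + 1 [ZMOD n]) :
    transposition n x (x + 1) h = simpleReflection n x := by
  apply Subtype.ext; ext y
  rw [simpleReflection_apply, transposition_apply, transpositionFun]
  simp only [← ZMod.intCast_eq_intCast_iff]
  push_cast
  split_ifs <;> ring

/-- Each integer moves by at most one, so only distances one and two could matter; at distance two a
collision would force `1 = 0` modulo `n`. Thus the translates of one adjacent pair are the only
pairs that `s_i` inverts. -/
theorem simpleReflection_lt (i : ZMod n) {x y : ℤ} (h : x < y)
    (hne : ¬ ((x : ZMod n) = i ∧ y = x + 1)) :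
    (simpleReflection n i).1 x < (simpleReflection n i).1 y := by
  simp only [simpleReflection_apply]
  have h1 : y = x + 1 → (y : ZMod n) = x + 1 := by rintro rfl; simp
  have h2 : y = x + 2 → (x : ZMod n) = i → (y : ZMod n) ≠ i + 1 := by
    rintro rfl rfl; simp
    intro h
    have : (1 : ZMod n) = 0 := by linear_combination h
    exact one_ne_zero this
  by_cases hy : y = x + 1
  · have h1 := h1 hy
    have hxi : (x : ZMod n) ≠ i := fun h' => hne ⟨h', hy⟩
    have hyi : (y : ZMod n) ≠ i + 1 := fun h' => hxi (by rw [h1] at h'; exact add_right_cancel h')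
    simp only [hxi, hyi, if_false]
    split_ifs <;> omega
  · by_cases hy2 : y = x + 2
    · by_cases hxi : (x : ZMod n) = i
      · have := h2 hy2 hxi
        simp only [hxi, this, if_true, if_false]
        split_ifs <;> omega
      · simp only [hxi, if_false]
        split_ifs <;> omega
    · split_ifs <;> omega

theorem wordProd_nil : wordProd n [] = 1 := rfl

theorem wordProd_append (a b : List (ZMod n)) :
    wordProd n (a ++ b) = wordProd n a * wordProd n b := by simp [wordProd]

theorem wordProd_concat (a : List (ZMod n)) (i : ZMod n) :
    wordProd n (a ++ [i]) = wordProd n a * simpleReflection n i := by simp [wordProd]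

/-- An element of the affine symmetric group without descents is the identity. -/
theorem eq_one_of_forall_lt (w : affineSymmetricGroup n) (h : ∀ x : ℤ, w.1 x < w.1 (x + 1)) :
    w = 1 := by
  have hn : 0 < n := NeZero.pos n
  have hstep : ∀ (x : ℤ) (k : ℕ), w.1 x + k ≤ w.1 (x + k) := by
    intro x k
    induction k with
    | zero => simp
    | succ k ih =>
      have := h (x + k)
      push_cast
      rw [← add_assoc]
      rw [← add_assoc]
      omega
  have hone : ∀ x : ℤ, w.1 (x + 1) = w.1 x + 1 := by
    intro x
    have h1 := h x
    -- A full period gains exactly `n`, and the other `n - 1` steps gain at least `n - 1`, so this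
    -- step gains exactly one.
    have h2 := hstep (x + 1) (n - 1)
    have h3 : x + 1 + ((n - 1 : ℕ) : ℤ) = x + n := by push_cast [Nat.cast_sub hn]; ring
    have := w.2.1 x
    rw [h3, this] at h2
    push_cast [Nat.cast_sub hn] at h2
    omega
  have hall : ∀ x : ℤ, w.1 x = w.1 0 + x := by
    intro x
    induction x using Int.induction_on with
    | zero => simp
    | succ k ih => rw [hone, ih]; ring
    | pred k ih =>
      have := hone (-(k : ℤ) - 1)
      rw [show -(k : ℤ) - 1 + 1 = -k by ring, ih] at this
      linarith
  have hsum := w.2.2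
  rw [Finset.sum_congr rfl (fun x _ => hall x), Finset.sum_add_distrib] at hsum
  simp only [Finset.sum_const, Int.card_Icc] at hsum
  -- What is left is a translation, and the normalization of the window sum makes it trivial.
  have h0 : w.1 0 = 0 := by
    have h1 : ((n : ℤ) + 1 - 1).toNat • w.1 0 = 0 := by linarith
    have h2 : ((n : ℤ) + 1 - 1).toNat = n := by omega
    rw [h2] at h1
    simpa [hn.ne'] using h1
  apply Subtype.ext; ext x
  rw [hall, h0]; simp

/-- The total squared displacement over a window. -/
noncomputable def energy (w : affineSymmetricGroup n) : ℤ := ∑ j ∈ Finset.Icc (1 : ℤ) n, (w.1 j - j) ^ 2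

/-- Sorting a descent strictly lowers the squared displacement; this is the termination measure for
writing an element as a word. -/
theorem energy_mul_simpleReflection (w : affineSymmetricGroup n) (x : ℤ) :
    energy (w * simpleReflection n x) = energy w - 2 * (w.1 x - w.1 (x + 1)) := by
  set s := simpleReflection n x with hs
  have hn : 1 < n := Fact.out
  have hss : ∀ y, s.1 (s.1 y) = y := simpleReflection_simpleReflection_apply _
  have h1 : energy (w * s) = ∑ j ∈ Finset.Icc (1 : ℤ) n, (w.1 j - s.1 j) ^ 2 := by
    rw [← sum_window_comp n s.1 s.2.1 (fun j => (w.1 j - s.1 j) ^ 2)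
      (fun j => by simp [w.2.1, s.2.1])]
    simp [energy, hss]
  have h2 : energy (w * s) - energy w =
      ∑ j ∈ Finset.Icc (1 : ℤ) n, ((w.1 j - s.1 j) ^ 2 - (w.1 j - j) ^ 2) := by
    rw [h1, energy, Finset.sum_sub_distrib]
  -- The window is moved to start at `x`, so that the only positions in it moved by `s` are its
  -- first two.
  rw [← sum_window_comp n (Equiv.addRight (x - 1)) (fun i => by simp; ring)
      (fun j => (w.1 j - s.1 j) ^ 2 - (w.1 j - j) ^ 2)
      (fun j => by simp [w.2.1, s.2.1])] at h2
  rw [Finset.sum_eq_add_of_mem (1 : ℤ) 2 (by simp; omega) (by simp; omega) (by norm_num)] at h2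
  · have e1 : (Equiv.addRight (x - 1)) (1 : ℤ) = x := by simp
    have e2 : (Equiv.addRight (x - 1)) (2 : ℤ) = x + 1 := by simp; ring
    have s1 : s.1 x = x + 1 := by simp [hs, simpleReflection_apply]
    have s2 : s.1 (x + 1) = x := by simp [hs, simpleReflection_apply]
    rw [e1, e2, s1, s2] at h2
    linarith
  · intro c hc hne
    have hc' := Finset.mem_Icc.1 hc
    have : s.1 (c + (x - 1)) = c + (x - 1) := by
      rw [hs, simpleReflection_apply, if_neg, if_neg]
      · rw [← sub_eq_zero]
        intro h
        have : ((c - 2 : ℤ) : ZMod n) = 0 := by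
          rw [← h]; push_cast; ring
        rw [ZMod.intCast_zmod_eq_zero_iff_dvd] at this
        obtain ⟨k, hk⟩ := this
        have : k < 1 := by nlinarith
        have : -1 < k := by nlinarith [hne.1]
        have : k = 0 := by omega
        subst this
        exact hne.2 (by linarith)
      · rw [← sub_eq_zero]
        intro h
        have : ((c - 1 : ℤ) : ZMod n) = 0 := by
          rw [← h]; push_cast; ring
        rw [ZMod.intCast_zmod_eq_zero_iff_dvd] at this
        obtain ⟨k, hk⟩ := this
        have : k < 1 := by nlinarith
        have : -1 < k := by nlinarith
        have : k = 0 := by omega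
        subst this
        exact hne.1 (by linarith)
    simp [this]

/-- The simple reflections generate the affine symmetric group. -/
theorem exists_wordProd_eq (w : affineSymmetricGroup n) : ∃ a, wordProd n a = w := by
  induction hm : (energy w).toNat using Nat.strong_induction_on generalizing w with
  | _ m ih =>
    by_cases h : ∀ x : ℤ, w.1 x < w.1 (x + 1)
    · exact ⟨[], (eq_one_of_forall_lt w h).symm⟩
    · push Not at h
      obtain ⟨x, hx⟩ := h
      have hne : w.1 (x + 1) ≠ w.1 x := fun h => by
        have := w.1.injective h
        omega
      have he := energy_mul_simpleReflection w x
      have hpos : 0 ≤ energy (w * simpleReflection n x) :=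
        Finset.sum_nonneg fun _ _ => sq_nonneg _
      have hlt : w.1 (x + 1) < w.1 x := lt_of_le_of_ne hx hne
      obtain ⟨a, ha⟩ := ih _ (by omega) (w * simpleReflection n x) rfl
      exact ⟨a ++ [(x : ZMod n)], by rw [wordProd_concat, ha, mul_simpleReflection_cancel]⟩

end Simple

/-! ### Length, strong exchange and the lifting property. -/

section Length

variable {n : ℕ} [NeZero n] [Fact (1 < n)]

theorem length_wordProd_le (a : List (ZMod n)) : length (wordProd n a) ≤ a.length :=
  Nat.sInf_le ⟨a, rfl, rfl⟩

theorem exists_isReducedWord (w : affineSymmetricGroup n) : ∃ a, IsReducedWord a w := by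
  obtain ⟨a, ha⟩ := exists_wordProd_eq w
  obtain ⟨b, hb, hbw⟩ := Nat.sInf_mem
    (s := {l | ∃ a : List (ZMod n), a.length = l ∧ wordProd n a = w}) ⟨_, a, rfl, ha⟩
  exact ⟨b, hbw, hb⟩

theorem length_one : length (1 : affineSymmetricGroup n) = 0 :=
  Nat.le_zero.1 (length_wordProd_le [])

theorem length_eq_zero_iff {w : affineSymmetricGroup n} : length w = 0 ↔ w = 1 := by
  refine ⟨fun h => ?_, fun h => h ▸ length_one⟩
  obtain ⟨a, ha, hl⟩ := exists_isReducedWord w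
  rw [h, List.length_eq_zero_iff] at hl
  rw [← ha, hl, wordProd_nil]

theorem length_mul_le (u w : affineSymmetricGroup n) : length (u * w) ≤ length u + length w := by
  obtain ⟨a, ha, hl⟩ := exists_isReducedWord u
  obtain ⟨b, hb, hl'⟩ := exists_isReducedWord w
  have := length_wordProd_le (a ++ b)
  rw [wordProd_append, ha, hb, List.length_append] at this
  omega

theorem length_simpleReflection_le (i : ZMod n) : length (simpleReflection n i) ≤ 1 := by
  have := length_wordProd_le [i]
  simpa [wordProd] using this

theorem finite_length_eq (k : ℕ) : {w : affineSymmetricGroup n | length w = k}.Finite := by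
  refine ((List.finite_length_eq (ZMod n) k).image (wordProd n)).subset ?_
  intro w hw
  obtain ⟨a, ha, hl⟩ := exists_isReducedWord w
  exact ⟨a, hl.trans hw, ha⟩

theorem transposition_mul_simpleReflection (i : ZMod n) {r s : ℤ} (h : ¬ r ≡ s [ZMOD n]) :
    ∃ h' : ¬ (simpleReflection n i).1 r ≡ (simpleReflection n i).1 s [ZMOD n],
      transposition n r s h * simpleReflection n i =
        simpleReflection n i * transposition n _ _ h' := by
  have h' : ¬ (simpleReflection n i).1 r ≡ (simpleReflection n i).1 s [ZMOD n] := by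
    rwa [apply_modEq_iff]
  refine ⟨h', ?_⟩
  have := mul_transposition (simpleReflection n i) h h'
  have h2 := congrArg (fun w => simpleReflection n i * (w * simpleReflection n i)) this
  simp only [mul_simpleReflection_cancel] at h2
  rw [← h2, ← mul_assoc, ← mul_assoc, simpleReflection_mul_self, one_mul]

/-- Strong exchange. Follow the pair `r < q` through the letters from the right: since it ends up
inverted, some letter meets it as an adjacent pair and swaps it. Deleting that letter multiplies the
product by the transposition. -/
theorem exists_shorter_word (a : List (ZMod n)) {r q : ℤ} (h : ¬ r ≡ q [ZMOD n]) (hrq : r < q)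
    (ha : (wordProd n a).1 q < (wordProd n a).1 r) :
    ∃ b : List (ZMod n), b.length < a.length ∧
      wordProd n b = wordProd n a * transposition n r q h := by
  induction a using List.reverseRecOn generalizing r q with
  | nil => simp [wordProd_nil] at ha; omega
  | append_singleton a i ih =>
    rw [wordProd_concat] at ha ⊢
    by_cases hc : (r : ZMod n) = i ∧ q = r + 1
    · obtain ⟨rfl, rfl⟩ := hc
      refine ⟨a, by simp, ?_⟩
      rw [transposition_add_one, mul_simpleReflection_cancel]
    · obtain ⟨h', he⟩ := transposition_mul_simpleReflection i h
      obtain ⟨b, hb, hbe⟩ := ih h' (simpleReflection_lt i hrq hc) ha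
      refine ⟨b ++ [i], by simpa using hb, ?_⟩
      rw [wordProd_concat, hbe, mul_assoc, mul_assoc]
      congr 1
      have h2 := congrArg (fun w => simpleReflection n i * w * simpleReflection n i) he
      simp only [mul_assoc, simpleReflection_mul_self, mul_one] at h2
      rw [h2, ← mul_assoc (simpleReflection n i) (simpleReflection n i),
        simpleReflection_mul_self, one_mul]

theorem length_mul_transposition_lt_iff (x : affineSymmetricGroup n) {r q : ℤ}
    (h : ¬ r ≡ q [ZMOD n]) (hrq : r < q) :
    length (x * transposition n r q h) < length x ↔ x.1 q < x.1 r := by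
  have key : ∀ x : affineSymmetricGroup n, x.1 q < x.1 r →
      length (x * transposition n r q h) < length x := by
    intro x hx
    obtain ⟨a, ha, hl⟩ := exists_isReducedWord x
    obtain ⟨b, hb, hbe⟩ := exists_shorter_word a h hrq (by rwa [ha])
    have := length_wordProd_le b
    rw [hbe, ha] at this
    omega
  refine ⟨fun hlt => ?_, key x⟩
  by_contra hx
  have hne : x.1 q ≠ x.1 r := fun e => hrq.ne' (x.1.injective e)
  have h1 : x.1 r < x.1 q := by omega
  -- For the converse, exchange is applied to the product, whose values at `r` and `q` are those of
  -- `x` swapped.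
  have h2 := key (x * transposition n r q h) (by
    simp only [Subgroup.coe_mul, Equiv.Perm.mul_apply]
    rwa [transposition_apply_left, transposition_apply_right])
  rw [mul_assoc, transposition_mul_self, mul_one] at h2
  omega

theorem length_mul_simpleReflection (w : affineSymmetricGroup n) (i : ZMod n) :
    length (w * simpleReflection n i) = length w + 1 ∨
      length (w * simpleReflection n i) + 1 = length w := by
  have h1 := length_mul_le w (simpleReflection n i)
  have h2 := length_mul_le (w * simpleReflection n i) (simpleReflection n i)
  rw [mul_simpleReflection_cancel] at h2
  have h3 := length_simpleReflection_le i
  have h4 : length (w * simpleReflection n i) ≠ length w := by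
    have e := length_mul_transposition_lt_iff w (not_modEq_add_one (n := n) i.val) (by omega)
    have e' := length_mul_transposition_lt_iff (w * simpleReflection n i)
      (not_modEq_add_one (n := n) i.val) (by omega)
    have hv : ((i.val : ℤ) : ZMod n) = i := by simp
    rw [transposition_add_one, hv] at e e'
    rw [mul_simpleReflection_cancel] at e'
    have hne : w.1 (i.val + 1) ≠ w.1 i.val := fun h => by
      have := w.1.injective h
      omega
    have e1 : (w * simpleReflection n i).1 (i.val + 1) = w.1 i.val := by
      simp [simpleReflection_apply]
    have e2 : (w * simpleReflection n i).1 i.val = w.1 (i.val + 1) := by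
      simp [simpleReflection_apply]
    rw [e1, e2] at e'
    omega
  omega

theorem length_mul_simpleReflection_of_lt (w : affineSymmetricGroup n) (x : ℤ)
    (h : w.1 x < w.1 (x + 1)) : length (w * simpleReflection n x) = length w + 1 := by
  have e := length_mul_transposition_lt_iff w (not_modEq_add_one (n := n) x) (by omega)
  rw [transposition_add_one] at e
  have := length_mul_simpleReflection w (x : ZMod n)
  omega

/-- The lifting property for a single reflection: unless the reflection is `s_i` itself, conjugating
by `s_i` preserves the order of the pair it exchanges, so the inversion criterion carries over. -/
theorem length_mul_simpleReflection_lt_of_lt (x : affineSymmetricGroup n) (i : ZMod n)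
    (hx : length x < length (x * simpleReflection n i)) {a b : ℤ} (h : ¬ a ≡ b [ZMOD n])
    (hy : length (x * simpleReflection n i * transposition n a b h) <
      length (x * simpleReflection n i)) :
    x * simpleReflection n i * transposition n a b h = x ∨
      length (x * simpleReflection n i * transposition n a b h * simpleReflection n i) <
        length x := by
  wlog hab : a < b generalizing a b
  · have h' : ¬ b ≡ a [ZMOD n] := fun h' => h h'.symm
    have hne : a ≠ b := by rintro rfl; exact h rfl
    rw [← transposition_comm h h'] at hy ⊢
    exact this h' hy (by omega)
  rw [length_mul_transposition_lt_iff _ h hab] at hy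
  by_cases hc : (a : ZMod n) = i ∧ b = a + 1
  · obtain ⟨rfl, rfl⟩ := hc
    left
    rw [transposition_add_one, mul_simpleReflection_cancel]
  · right
    obtain ⟨h', he⟩ := transposition_mul_simpleReflection i h
    rw [mul_assoc, he, ← mul_assoc, mul_simpleReflection_cancel,
      length_mul_transposition_lt_iff _ h' (simpleReflection_lt i hab hc)]
    exact hy

theorem StrongCover.exists_conj {v w : affineSymmetricGroup n} (i : ZMod n)
    (h : ∃ (r s : ℤ) (h : ¬ r ≡ s [ZMOD n]), w = v * transposition n r s h) :
    ∃ (r s : ℤ) (h : ¬ r ≡ s [ZMOD n]),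
      w * simpleReflection n i = v * simpleReflection n i * transposition n r s h := by
  obtain ⟨r, s, h, rfl⟩ := h
  obtain ⟨h', he⟩ := transposition_mul_simpleReflection i h
  exact ⟨_, _, h', by rw [mul_assoc, he, mul_assoc]⟩

theorem strongCover_mul_simpleReflection_self (v : affineSymmetricGroup n) (i : ZMod n) :
    StrongCover v (v * simpleReflection n i) ↔ length v < length (v * simpleReflection n i) := by
  constructor
  · rintro ⟨-, h⟩; omega
  · intro h
    refine ⟨⟨i.val, i.val + 1, not_modEq_add_one _, ?_⟩, ?_⟩
    · rw [transposition_add_one]; simp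
    · have := length_mul_simpleReflection v i
      omega

/-- Conjugating the reflection by `s_i` turns one cover into the other, and lifting forces the
lengths. Excluding `w = v` removes the case where that reflection is `s_i`, which gives the scalar
term of the Leibniz rule. -/
theorem strongCover_mul_simpleReflection_iff {v w : affineSymmetricGroup n} (i : ZMod n)
    (hne : w ≠ v) :
    (StrongCover v (w * simpleReflection n i) ∧ length w < length (w * simpleReflection n i)) ↔
      (length (v * simpleReflection n i) < length v ∧
        StrongCover (v * simpleReflection n i) w) := by
  have hw := length_mul_simpleReflection w i
  have hv := length_mul_simpleReflection v i
  constructor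
  · rintro ⟨⟨⟨a, b, h, he⟩, hl⟩, hlt⟩
    have hv' : v = w * simpleReflection n i * transposition n a b h := by
      rw [he, mul_assoc, transposition_mul_self, mul_one]
    have h1 := length_mul_simpleReflection_lt_of_lt w i hlt h (by rw [← hv']; omega)
    rw [← hv'] at h1
    have h2 := h1.resolve_left hne.symm
    refine ⟨by omega, ?_, by omega⟩
    have := StrongCover.exists_conj i ⟨a, b, h, he⟩
    rwa [mul_simpleReflection_cancel] at this
  · rintro ⟨hlt, ⟨a, b, h, he⟩, hl⟩
    have hlt' : length w < length (w * simpleReflection n i) := by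
      by_contra hcon
      have h3 : v * simpleReflection n i = w * transposition n a b h := by
        rw [he, mul_assoc, transposition_mul_self, mul_one]
      have h1 := length_mul_simpleReflection_lt_of_lt (w * simpleReflection n i) i
        (by rw [mul_simpleReflection_cancel]; omega) h
        (by rw [mul_simpleReflection_cancel, ← h3]; omega)
      rw [mul_simpleReflection_cancel, ← h3, mul_simpleReflection_cancel] at h1
      rcases h1 with h1 | h1
      · exact hne (mul_right_cancel h1).symm
      · omega
    refine ⟨⟨?_, by omega⟩, hlt'⟩
    have := StrongCover.exists_conj i ⟨a, b, h, he⟩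
    rwa [mul_simpleReflection_cancel] at this

end Length

/-! ### Signed `r`-covers and right multiplication by a simple reflection. -/

section Chevalley

variable {n : ℕ} [NeZero n] [Fact (1 < n)]

open Classical in
/-- `1` if `w` is a right `r`-cover of `v`, `-1` if it is a left `r`-cover, `0` otherwise. -/
noncomputable def coverSign (r : ℤ) (v w : affineSymmetricGroup n) : ℤ :=
  if StrongCover v w then Int.sign ((v⁻¹ * w).1 r - r) else 0

/-- A reflection that moves `r` is determined by the image of `r`, so being a right or left cover
depends only on the direction in which `v⁻¹ * w` moves `r`. -/
theorem mem_rightCovers_iff {r : ℤ} {v w : affineSymmetricGroup n} :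
    w ∈ rightCovers r v ↔ StrongCover v w ∧ r < (v⁻¹ * w).1 r := by
  constructor
  · rintro ⟨hc, s, h, hs, rfl⟩
    refine ⟨hc, ?_⟩
    rwa [inv_mul_cancel_left, transposition_apply_left]
  · rintro ⟨hc, hr⟩
    obtain ⟨⟨a, b, h, rfl⟩, -⟩ := id hc
    rw [inv_mul_cancel_left] at hr
    obtain ⟨h', he⟩ := transposition_eq_of_apply_ne h hr.ne'
    exact ⟨hc, _, h', hr, by rw [← he]⟩

theorem mem_leftCovers_iff {r : ℤ} {v w : affineSymmetricGroup n} :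
    w ∈ leftCovers r v ↔ StrongCover v w ∧ (v⁻¹ * w).1 r < r := by
  constructor
  · rintro ⟨hc, s, h, hs, rfl⟩
    refine ⟨hc, ?_⟩
    rwa [inv_mul_cancel_left, transposition_apply_right]
  · rintro ⟨hc, hr⟩
    obtain ⟨⟨a, b, h, rfl⟩, -⟩ := id hc
    rw [inv_mul_cancel_left] at hr
    obtain ⟨h', he⟩ := transposition_eq_of_apply_ne h hr.ne
    exact ⟨hc, _, fun h => h' h.symm, hr, by rw [transposition_comm h', ← he]⟩

theorem coverSign_mul_simpleReflection_self (r : ℤ) (v : affineSymmetricGroup n) (i : ZMod n) :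
    coverSign r v (v * simpleReflection n i) =
      if length v < length (v * simpleReflection n i) then
        Int.sign ((simpleReflection n i).1 r - r) else 0 := by
  simp only [coverSign, strongCover_mul_simpleReflection_self, inv_mul_cancel_left]

/-- The image of a reflection under conjugation by `s_i` moves `s_i r` in the same direction as
the reflection moves `r`. -/
theorem sign_conj_simpleReflection (i : ZMod n) {a b : ℤ} (h : ¬ a ≡ b [ZMOD n]) (r : ℤ)
    (hne : transposition n a b h ≠ simpleReflection n i) :
    Int.sign ((simpleReflection n i).1 ((transposition n a b h).1 r) -
      (simpleReflection n i).1 r) = Int.sign ((transposition n a b h).1 r - r) := by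
  by_cases hr : (transposition n a b h).1 r = r
  · simp [hr]
  obtain ⟨h', he⟩ := transposition_eq_of_apply_ne h hr
  generalize (transposition n a b h).1 r = q at *
  rcases lt_or_gt_of_ne hr with hlt | hlt
  · have : ¬ ((q : ZMod n) = i ∧ r = q + 1) := by
      rintro ⟨rfl, rfl⟩
      apply hne
      have h'' : ¬ q ≡ q + 1 [ZMOD n] := not_modEq_add_one q
      rw [he, transposition_comm h'' h', transposition_add_one]
    have := simpleReflection_lt i hlt this
    rw [Int.sign_eq_neg_one_of_neg (by omega), Int.sign_eq_neg_one_of_neg (by omega)]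
  · have : ¬ ((r : ZMod n) = i ∧ q = r + 1) := by
      rintro ⟨rfl, rfl⟩
      exact hne (by rw [he, transposition_add_one])
    have := simpleReflection_lt i hlt this
    rw [Int.sign_eq_one_of_pos (by omega), Int.sign_eq_one_of_pos (by omega)]

open Classical in
-- The Leibniz rule, entry by entry. For `w ≠ v` the covers on the two sides correspond and have
-- equal signs. For `w = v` exactly one of the two length conditions holds: on an ascent the left
-- side equals the extra term, on a descent the two terms on the right cancel.
theorem coverSign_mul_simpleReflection (r : ℤ) (v w : affineSymmetricGroup n) (i : ZMod n) :
    (if length w < length (w * simpleReflection n i) then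
        coverSign r v (w * simpleReflection n i) else 0) =
      (if length (v * simpleReflection n i) < length v then
        coverSign ((simpleReflection n i).1 r) (v * simpleReflection n i) w else 0) +
      if w = v then Int.sign ((simpleReflection n i).1 r - r) else 0 := by
  by_cases hwv : w = v
  · subst hwv
    have h := coverSign_mul_simpleReflection_self ((simpleReflection n i).1 r)
      (w * simpleReflection n i) i
    rw [mul_simpleReflection_cancel, simpleReflection_simpleReflection_apply] at h
    rw [coverSign_mul_simpleReflection_self, h, if_pos rfl, ← neg_sub, Int.sign_neg]
    have := length_mul_simpleReflection w i
    split_ifs <;> omega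
  · rw [if_neg hwv, add_zero]
    have key := strongCover_mul_simpleReflection_iff i hwv
    by_cases hc : StrongCover v (w * simpleReflection n i) ∧
        length w < length (w * simpleReflection n i)
    · have hc' := key.1 hc
      rw [if_pos hc.2, if_pos hc'.1, coverSign, coverSign, if_pos hc.1, if_pos hc'.2]
      obtain ⟨⟨a, b, h, he⟩, -⟩ := hc.1
      have hw : w = v * transposition n a b h * simpleReflection n i := by
        rw [← he, mul_simpleReflection_cancel]
      have hne : transposition n a b h ≠ simpleReflection n i := by
        intro h0
        rw [h0, mul_simpleReflection_cancel] at hw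
        exact hwv hw
      rw [he, inv_mul_cancel_left, ← sign_conj_simpleReflection i h r hne, mul_inv_rev,
        simpleReflection_inv]
      have e : simpleReflection n i * v⁻¹ * w =
          simpleReflection n i * transposition n a b h * simpleReflection n i := by
        rw [hw]; group
      rw [e]
      simp only [Subgroup.coe_mul, Equiv.Perm.mul_apply, simpleReflection_simpleReflection_apply]
    · have hc' := (not_congr key).1 hc
      have h1 : (if length w < length (w * simpleReflection n i) then
          coverSign r v (w * simpleReflection n i) else 0) = 0 := by
        split_ifs with h
        · exact if_neg fun h' => hc ⟨h', h⟩
        · rfl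
      have h2 : (if length (v * simpleReflection n i) < length v then
          coverSign ((simpleReflection n i).1 r) (v * simpleReflection n i) w else 0) = 0 := by
        split_ifs with h
        · exact if_neg fun h' => hc' ⟨h, h'⟩
        · rfl
      rw [h1, h2]

end Chevalley

/-! ### NilCoxeter multiplication, the signed cover operator and its Leibniz rule. -/

section Operators

variable {n : ℕ} [NeZero n] [Fact (1 < n)]

/-- Right multiplication by `g` in the affine nilCoxeter algebra, acting on the coefficients of
an element: `T_g (∑ f w A_w) = ∑ f w A_w A_g`. -/
noncomputable def nilMul (g : affineSymmetricGroup n) :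
    (affineSymmetricGroup n → ℤ) →ₗ[ℤ] (affineSymmetricGroup n → ℤ) where
  toFun f w := if length (w * g⁻¹) + length g = length w then f (w * g⁻¹) else 0
  map_add' f f' := by
    ext w
    simp only [Pi.add_apply]
    split_ifs <;> simp
  map_smul' c f := by
    ext w
    simp only [Pi.smul_apply, RingHom.id_apply]
    split_ifs <;> simp

theorem nilMul_apply (g : affineSymmetricGroup n) (f : affineSymmetricGroup n → ℤ)
    (w : affineSymmetricGroup n) :
    nilMul g f w = if length (w * g⁻¹) + length g = length w then f (w * g⁻¹) else 0 := rfl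

/-- The signed sum of the coefficients of `f` over the `r`-covers of a given element. -/
noncomputable def coverSum (r : ℤ) :
    (affineSymmetricGroup n → ℤ) →ₗ[ℤ] (affineSymmetricGroup n → ℤ) where
  toFun f v := ∑ w ∈ (finite_length_eq (n := n) (length v + 1)).toFinset, coverSign r v w * f w
  map_add' f f' := by
    ext v
    simp [mul_add, Finset.sum_add_distrib]
  map_smul' c f := by
    ext v
    simp [Finset.mul_sum, mul_left_comm]

theorem coverSign_ne_zero {r : ℤ} {v w : affineSymmetricGroup n} (h : coverSign r v w ≠ 0) :
    length w = length v + 1 := by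
  by_contra hl
  exact h (if_neg fun hc => hl hc.2)

theorem coverSum_apply (r : ℤ) (f : affineSymmetricGroup n → ℤ) (v : affineSymmetricGroup n) :
    coverSum r f v = ∑ᶠ w, coverSign r v w * f w := by
  symm
  apply finsum_eq_sum_of_support_subset
  intro w hw
  simp only [Set.Finite.coe_toFinset, Set.mem_ofPred_eq]
  exact coverSign_ne_zero (left_ne_zero_of_mul hw)

theorem length_simpleReflection (i : ZMod n) : length (simpleReflection n i) = 1 := by
  have h := length_mul_simpleReflection 1 i
  rw [one_mul, length_one] at h
  omega

theorem nilMul_simpleReflection_apply (i : ZMod n) (f : affineSymmetricGroup n → ℤ)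
    (w : affineSymmetricGroup n) :
    nilMul (simpleReflection n i) f w =
      if length (w * simpleReflection n i) < length w then f (w * simpleReflection n i) else 0 := by
  rw [nilMul_apply, simpleReflection_inv, length_simpleReflection]
  have h := length_mul_simpleReflection w i
  congr 1
  rw [eq_iff_iff]
  omega

/-- Subadditivity of length makes the single length condition for `g s_i` equivalent to the two
successive conditions for `g` and `s_i`. -/
theorem nilMul_mul_simpleReflection (g : affineSymmetricGroup n) (i : ZMod n)
    (hg : length (g * simpleReflection n i) = length g + 1) (f : affineSymmetricGroup n → ℤ) :
    nilMul (g * simpleReflection n i) f = nilMul (simpleReflection n i) (nilMul g f) := by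
  ext w
  rw [nilMul_simpleReflection_apply]
  simp only [nilMul_apply, mul_inv_rev, simpleReflection_inv, hg, ← mul_assoc]
  have h1 := length_mul_simpleReflection w i
  have h2 := length_mul_le (w * simpleReflection n i * g⁻¹) g
  rw [inv_mul_cancel_right] at h2
  split_ifs <;> first | rfl | omega

/-- The Leibniz rule for multiplication by a generator. -/
theorem coverSum_nilMul_simpleReflection (r : ℤ) (i : ZMod n) (f : affineSymmetricGroup n → ℤ) :
    coverSum r (nilMul (simpleReflection n i) f) =
      nilMul (simpleReflection n i) (coverSum ((simpleReflection n i).1 r) f) +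
        Int.sign ((simpleReflection n i).1 r - r) • f := by
  classical
  ext v
  rw [coverSum_apply, ← finsum_comp_equiv (Equiv.mulRight (simpleReflection n i))]
  simp only [Equiv.coe_mulRight, nilMul_simpleReflection_apply, mul_simpleReflection_cancel,
    Pi.add_apply, Pi.smul_apply, smul_eq_mul]
  have h : ∀ w, coverSign r v (w * simpleReflection n i) *
      (if length w < length (w * simpleReflection n i) then f w else 0) =
      (if length (v * simpleReflection n i) < length v then
        coverSign ((simpleReflection n i).1 r) (v * simpleReflection n i) w * f w else 0) +
      if w = v then Int.sign ((simpleReflection n i).1 r - r) * f w else 0 := by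
    intro w
    have := congrArg (· * f w) (coverSign_mul_simpleReflection r v w i)
    simpa only [add_mul, ite_mul, mul_ite, zero_mul, mul_zero] using this
  rw [finsum_congr h, finsum_add_distrib]
  · congr 1
    · split_ifs with hv
      · rw [coverSum_apply]
      · simp
    · rw [finsum_eq_single _ v (fun w hw => if_neg hw), if_pos rfl]
  · refine (finite_length_eq (length (v * simpleReflection n i) + 1)).subset fun w hw => ?_
    have hw' := Function.mem_support.1 hw
    split_ifs at hw'
    · exact coverSign_ne_zero (left_ne_zero_of_mul hw')
    · exact absurd rfl hw'
  · refine (Set.finite_singleton v).subset fun w hw => ?_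
    by_contra hne
    exact hw (if_neg hne)

end Operators

/-! ### Cyclically decreasing elements and proper subsets of `ℤ/nℤ`. -/

section CyclicallyDecreasing

variable {n : ℕ} [NeZero n] [Fact (1 < n)]

/-- The combinatorial condition on cyclically decreasing words (which implies that the word is
reduced). -/
def CyclicOrder (a : List (ZMod n)) : Prop :=
  a.Nodup ∧ ∀ i, i ∈ a → i + 1 ∈ a → a.idxOf (i + 1) < a.idxOf i

theorem cyclicOrder_nil : CyclicOrder ([] : List (ZMod n)) := by simp [CyclicOrder]

/-- A last letter `i` may follow `i + 1` but not `i - 1`. This drives every induction on such words: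
a new letter starts a run of consecutive letters. -/
theorem cyclicOrder_concat {a : List (ZMod n)} {i : ZMod n} :
    CyclicOrder (a ++ [i]) ↔ CyclicOrder a ∧ i ∉ a ∧ i - 1 ∉ a := by
  have hidx : ∀ j ∈ a, (a ++ [i]).idxOf j = a.idxOf j := fun j hj =>
    List.idxOf_append_of_mem hj
  have hidx' : i ∉ a → (a ++ [i]).idxOf i = a.length := fun hi => by
    rw [List.idxOf_append_of_notMem hi]; simp
  constructor
  · rintro ⟨h1, h2⟩
    have hnd : a.Nodup ∧ i ∉ a := by
      rw [List.nodup_append] at h1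
      exact ⟨h1.1, fun hi => h1.2.2 i hi i (by simp) rfl⟩
    refine ⟨⟨hnd.1, fun j hj hj' => ?_⟩, hnd.2, fun hi => ?_⟩
    · have := h2 j (by simp [hj]) (by simp [hj'])
      rwa [hidx _ hj, hidx _ hj'] at this
    · have := h2 (i - 1) (by simp [hi]) (by simp)
      rw [sub_add_cancel, hidx' hnd.2, hidx _ hi] at this
      have := List.idxOf_lt_length_of_mem hi
      omega
  · rintro ⟨⟨h1, h2⟩, h3, h4⟩
    refine ⟨?_, fun j hj hj' => ?_⟩
    · rw [List.nodup_append]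
      refine ⟨h1, by simp, ?_⟩
      rintro x hx y hy rfl
      simp at hy
      exact h3 (hy ▸ hx)
    · simp only [List.mem_append, List.mem_singleton] at hj hj'
      rcases hj with hj | rfl
      · rcases hj' with hj' | hj'
        · rw [hidx _ hj, hidx _ hj']
          exact h2 j hj hj'
        · rw [← hj', add_sub_cancel_right] at h4
          exact absurd hj h4
      · rcases hj' with hj' | hj'
        · rw [hidx _ hj', hidx' h3]
          exact List.idxOf_lt_length_of_mem hj'
        · simp at hj'

theorem CyclicOrder.toFinset_ne_univ {a : List (ZMod n)} (ha : CyclicOrder a) :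
    a.toFinset ≠ Finset.univ := by
  intro h
  have hmem : ∀ i, i ∈ a := fun i => by
    rw [← List.mem_toFinset, h]; simp
  rcases List.eq_nil_or_concat a with rfl | ⟨b, i, rfl⟩
  · simpa using hmem 0
  · rw [List.concat_eq_append] at *
    have := (cyclicOrder_concat.1 ha).2.2
    have h1 := hmem (i - 1)
    simp only [List.mem_append, this, List.mem_singleton, false_or] at h1
    simp at h1

/-- The action of a cyclically decreasing product: `x` goes to `x - 1` if `x - 1` is a letter, and
to the end of the run of letters starting at `x` otherwise. -/
theorem CyclicOrder.wordProd_apply {a : List (ZMod n)} (ha : CyclicOrder a) (x : ℤ) :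
    ((x : ZMod n) - 1 ∈ a → (wordProd n a).1 x = x - 1) ∧
    ((x : ZMod n) - 1 ∉ a → ∃ m : ℕ, (wordProd n a).1 x = x + m ∧ (x : ZMod n) + m ∉ a ∧
      ∀ t : ℕ, t < m → (x : ZMod n) + t ∈ a) := by
  induction a using List.reverseRecOn generalizing x with
  | nil => simp [wordProd_nil]
  | append_singleton a i ih =>
    obtain ⟨h1, h2, h3⟩ := cyclicOrder_concat.1 ha
    have ih := ih h1
    rw [wordProd_concat]
    simp only [Subgroup.coe_mul, Equiv.Perm.mul_apply, simpleReflection_apply, List.mem_append,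
      List.mem_singleton]
    by_cases hx : (x : ZMod n) = i
    · subst hx
      have hne : (x : ZMod n) - 1 ≠ x := by simp
      simp only [h3, hne, or_self, if_true, not_false_eq_true, forall_true_left, false_imp_iff,
        true_and]
      have hx1 : ((x + 1 : ℤ) : ZMod n) - 1 ∉ a := by simpa using h2
      -- The run from `x` is the new letter followed by the run of `a` from `x + 1`.
      obtain ⟨m, hm, hm1, hm2⟩ := (ih (x + 1)).2 hx1
      refine ⟨m + 1, ?_, ?_, ?_⟩
      · rw [hm]; push_cast; ring
      · push_cast at hm1 ⊢
        have e : (x : ZMod n) + (m + 1) = x + 1 + m := by ring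
        rw [e, not_or]
        refine ⟨hm1, fun h => ?_⟩
        -- The run cannot wrap around to `x`: it would first pass through `x - 1`, which is not a
        -- letter of `a`.
        rcases Nat.eq_zero_or_pos m with rfl | hpos
        · simp at h
        · apply h3
          have := hm2 (m - 1) (by omega)
          rw [Nat.cast_sub hpos] at this
          convert this using 1
          push_cast
          linear_combination -h
      · intro t ht
        rcases t with _ | t
        · simp
        · left
          have := hm2 t (by omega)
          push_cast at this ⊢
          convert this using 1
          ring
    · by_cases hx1 : (x : ZMod n) = i + 1
      · have e : (x : ZMod n) - 1 = i := by rw [hx1]; ring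
        have hx2 : ((x - 1 : ℤ) : ZMod n) = i := by push_cast; exact e
        simp only [hx, if_false]
        simp only [hx1, if_true]
        simp only [add_sub_cancel_right, or_true, not_true_eq_false, false_imp_iff, and_true,
          forall_true_left]
        obtain ⟨m, hm, hm1, hm2⟩ := (ih (x - 1)).2 (by rw [hx2]; exact h3)
        rcases Nat.eq_zero_or_pos m with rfl | hpos
        · rw [hm]; simp
        · have := hm2 0 hpos
          rw [hx2] at this
          simp [h2] at this
      · have hne : (x : ZMod n) - 1 ≠ i := fun h => hx1 (by rw [← h]; ring)
        simp only [hx, hx1, if_false, hne, or_false]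
        refine ⟨(ih x).1, fun h => ?_⟩
        obtain ⟨m, hm, hm1, hm2⟩ := (ih x).2 h
        refine ⟨m, hm, ?_, fun t ht => Or.inl (hm2 t ht)⟩
        rw [not_or]
        refine ⟨hm1, fun h' => ?_⟩
        rcases Nat.eq_zero_or_pos m with rfl | hpos
        · simp [hx] at h'
        · apply h3
          have := hm2 (m - 1) (by omega)
          rw [Nat.cast_sub hpos] at this
          convert this using 1
          push_cast
          linear_combination -h'

/-- The description of the action mentions only the set of letters. -/
theorem CyclicOrder.wordProd_eq {a b : List (ZMod n)} (ha : CyclicOrder a) (hb : CyclicOrder b)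
    (hab : a.toFinset = b.toFinset) : wordProd n a = wordProd n b := by
  have hmem : ∀ i, i ∈ a ↔ i ∈ b := fun i => by
    rw [← List.mem_toFinset, hab, List.mem_toFinset]
  apply Subtype.ext; ext x
  by_cases hx : (x : ZMod n) - 1 ∈ a
  · rw [(ha.wordProd_apply x).1 hx, (hb.wordProd_apply x).1 ((hmem _).1 hx)]
  · obtain ⟨m, hm, hm1, hm2⟩ := (ha.wordProd_apply x).2 hx
    obtain ⟨m', hm', hm1', hm2'⟩ := (hb.wordProd_apply x).2 (fun h => hx ((hmem _).2 h))
    have : m = m' := by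
      rcases lt_trichotomy m m' with h | h | h
      · exact absurd ((hmem _).2 (hm2' m h)) hm1
      · exact h
      · exact absurd ((hmem _).1 (hm2 m' h)) hm1'
    rw [hm, hm', this]

/-- The earlier letters fix `i` and do not lower `i + 1`, so each appended letter `i` is an ascent.
-/
theorem CyclicOrder.length_wordProd {a : List (ZMod n)} (ha : CyclicOrder a) :
    length (wordProd n a) = a.length := by
  induction a using List.reverseRecOn with
  | nil => exact length_one
  | append_singleton a i ih =>
    obtain ⟨h1, h2, h3⟩ := cyclicOrder_concat.1 ha
    have hv : ((i.val : ℤ) : ZMod n) = i := by simp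
    have h := length_mul_simpleReflection_of_lt (wordProd n a) (i.val : ℤ) (by
      obtain ⟨m, hm, -, hm2⟩ := (h1.wordProd_apply i.val).2 (by rwa [hv])
      obtain ⟨m', hm', -⟩ := (h1.wordProd_apply (i.val + 1)).2 (by
        push_cast; simpa using h2)
      have : m = 0 := by
        by_contra h0
        apply h2
        have := hm2 0 (by omega)
        simpa using this
      omega)
    rw [hv] at h
    rw [wordProd_concat, h, ih h1, List.length_append, List.length_singleton]

/-- Induction on proper subsets of `ℤ/nℤ`, adding an element that starts a run. -/
theorem proper_induction {P : Finset (ZMod n) → Prop} (h0 : P ∅)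
    (h1 : ∀ I i, i ∉ I → i - 1 ∉ I → P I → P (insert i I)) (I : Finset (ZMod n))
    (hI : I ≠ Finset.univ) : P I := by
  induction hk : I.card generalizing I with
  | zero => rw [Finset.card_eq_zero] at hk; rwa [hk]
  | succ k ih =>
    have hne : I.Nonempty := by rw [← Finset.card_pos]; omega
    obtain ⟨i, hi, hi'⟩ : ∃ i ∈ I, i - 1 ∉ I := by
      by_contra! hcon
      obtain ⟨y, hy⟩ := hne
      -- If no run had a start, stepping backwards from `y` would exhaust `ℤ/nℤ`.
      have hall : ∀ m : ℕ, y - m ∈ I := by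
        intro m
        induction m with
        | zero => simpa using hy
        | succ m ihm =>
          have := hcon _ ihm
          push_cast
          rwa [← sub_sub]
      apply hI
      rw [Finset.eq_univ_iff_forall]
      intro z
      have := hall (y - z).val
      simpa using this
    rw [← Finset.insert_erase hi]
    refine h1 _ _ (by simp) (fun h => hi' (Finset.mem_of_mem_erase h)) (ih _ ?_ ?_)
    · intro h
      have := Finset.mem_univ i
      rw [← h] at this
      simp at this
    · rw [Finset.card_erase_of_mem hi]; omega

theorem exists_cyclicOrder (I : Finset (ZMod n)) (hI : I ≠ Finset.univ) :
    ∃ a : List (ZMod n), CyclicOrder a ∧ a.toFinset = I := by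
  refine proper_induction (P := fun I => ∃ a : List (ZMod n), CyclicOrder a ∧ a.toFinset = I)
    ⟨[], cyclicOrder_nil, rfl⟩ ?_ I hI
  rintro I i h1 h2 ⟨a, ha, rfl⟩
  refine ⟨a ++ [i], cyclicOrder_concat.2 ⟨ha, by simpa using h1, by simpa using h2⟩, ?_⟩
  ext; simp

open Classical in
/-- The cyclically decreasing element with set of letters `I`, for a proper subset `I`. -/
noncomputable def cyc (I : Finset (ZMod n)) : affineSymmetricGroup n :=
  if h : ∃ a : List (ZMod n), CyclicOrder a ∧ a.toFinset = I then wordProd n h.choose else 1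

theorem CyclicOrder.cyc_toFinset {a : List (ZMod n)} (ha : CyclicOrder a) :
    cyc a.toFinset = wordProd n a := by
  have h : ∃ b : List (ZMod n), CyclicOrder b ∧ b.toFinset = a.toFinset := ⟨a, ha, rfl⟩
  rw [cyc, dif_pos h]
  exact h.choose_spec.1.wordProd_eq ha h.choose_spec.2

theorem cyc_empty : cyc (∅ : Finset (ZMod n)) = 1 := cyclicOrder_nil.cyc_toFinset

theorem cyc_insert {I : Finset (ZMod n)} {i : ZMod n} (hi : i ∉ I) (hi' : i - 1 ∉ I) :
    cyc (insert i I) = cyc I * simpleReflection n i := by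
  obtain ⟨a, ha, rfl⟩ := exists_cyclicOrder I (by rintro rfl; simp at hi)
  have h := cyclicOrder_concat.2 ⟨ha, by simpa using hi, by simpa using hi'⟩
  rw [ha.cyc_toFinset, ← wordProd_concat, ← h.cyc_toFinset]
  congr 1
  ext; simp

theorem length_cyc {I : Finset (ZMod n)} (hI : I ≠ Finset.univ) : length (cyc I) = I.card := by
  obtain ⟨a, ha, rfl⟩ := exists_cyclicOrder I hI
  rw [ha.cyc_toFinset, ha.length_wordProd, List.toFinset_card_of_nodup ha.1]

theorem length_cyc_mul {I : Finset (ZMod n)} {i : ZMod n} (hi : i ∉ I) (hi' : i - 1 ∉ I) :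
    length (cyc I * simpleReflection n i) = length (cyc I) + 1 := by
  obtain ⟨a, ha, rfl⟩ := exists_cyclicOrder I (by rintro rfl; simp at hi)
  have h := cyclicOrder_concat.2 ⟨ha, by simpa using hi, by simpa using hi'⟩
  rw [ha.cyc_toFinset, ← wordProd_concat, h.length_wordProd, ha.length_wordProd]
  simp

theorem cyc_apply_of_mem {I : Finset (ZMod n)} (hI : I ≠ Finset.univ) {x : ℤ}
    (hx : (x : ZMod n) - 1 ∈ I) : (cyc I).1 x = x - 1 := by
  obtain ⟨a, ha, rfl⟩ := exists_cyclicOrder I hI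
  rw [ha.cyc_toFinset]
  exact (ha.wordProd_apply x).1 (by simpa using hx)

theorem cyc_apply_of_notMem {I : Finset (ZMod n)} (hI : I ≠ Finset.univ) {x : ℤ}
    (hx : (x : ZMod n) - 1 ∉ I) : x ≤ (cyc I).1 x ∧ (((cyc I).1 x : ℤ) : ZMod n) ∉ I := by
  obtain ⟨a, ha, rfl⟩ := exists_cyclicOrder I hI
  rw [ha.cyc_toFinset]
  obtain ⟨m, hm, hm', -⟩ := (ha.wordProd_apply x).2 (by simpa using hx)
  rw [hm]
  refine ⟨by omega, ?_⟩
  push_cast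
  simpa using hm'

theorem cyc_apply_self {I : Finset (ZMod n)} {x : ℤ} (hx : (x : ZMod n) ∉ I)
    (hx' : (x : ZMod n) - 1 ∉ I) : (cyc I).1 x = x := by
  obtain ⟨a, ha, rfl⟩ := exists_cyclicOrder I (by rintro rfl; simp at hx)
  rw [ha.cyc_toFinset]
  obtain ⟨m, hm, -, hm'⟩ := (ha.wordProd_apply x).2 (by simpa using hx')
  rcases Nat.eq_zero_or_pos m with rfl | hpos
  · simpa using hm
  · exact absurd (hm' 0 hpos) (by simpa using hx)

/-- The letters can be read off the action: `i` is one exactly when `i + 1` is sent to `i`. -/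
theorem cyc_injOn : Set.InjOn (cyc (n := n)) {I | I ≠ Finset.univ} := by
  intro I hI J hJ h
  have key : ∀ K : Finset (ZMod n), K ≠ Finset.univ → ∀ i : ZMod n,
      i ∈ K ↔ (cyc K).1 (i.val + 1) = i.val := by
    intro K hK i
    have e : (((i.val : ℤ) + 1 : ℤ) : ZMod n) - 1 = i := by push_cast; simp
    constructor
    · intro hi
      rw [cyc_apply_of_mem hK (by rwa [e])]; ring
    · intro hi
      by_contra hcon
      have := (cyc_apply_of_notMem hK (by rwa [e])).1
      omega
  ext i
  rw [key I hI, key J hJ, h]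

theorem isCyclicallyDecreasing_iff {w : affineSymmetricGroup n} :
    IsCyclicallyDecreasing w ↔ ∃ I, I ≠ Finset.univ ∧ cyc I = w := by
  constructor
  · rintro ⟨a, ⟨rfl, -⟩, -, ha⟩
    have ha : CyclicOrder a := ha
    exact ⟨a.toFinset, ha.toFinset_ne_univ, ha.cyc_toFinset⟩
  · rintro ⟨I, hI, rfl⟩
    obtain ⟨a, ha, rfl⟩ := exists_cyclicOrder I hI
    exact ⟨a, ⟨ha.cyc_toFinset.symm, by rw [ha.cyc_toFinset, ha.length_wordProd]⟩,
      ⟨rfl, ha.length_wordProd.symm⟩, ha⟩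

end CyclicallyDecreasing

/-! ### The cancellation: `homMul` preserves the common kernel of the cover operators. -/

section Vanishing

variable {n : ℕ} [NeZero n] [Fact (1 < n)]

/-- The coefficient of `cyc J` in the signed sum of the elements of which `cyc (J ∪ {j})` is an
`r`-cover. -/
noncomputable def insertSign (r : ℤ) (J : Finset (ZMod n)) (j : ZMod n) : ℤ :=
  (if (((cyc J).1 r : ℤ) : ZMod n) = j then 1 else 0) - if (r : ZMod n) - 1 = j then 1 else 0

/-- If `r - 1` lies in `J`, then `r` is sent to `r - 1`, and neither indicator is seen outside `J`.
Otherwise the image of `r` also lies outside `J`, and the two indicators contribute `1 - 1`. -/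
theorem sum_insertSign (r : ℤ) (J : Finset (ZMod n)) : ∑ j ∈ Jᶜ, insertSign r J j = 0 := by
  by_cases hJ : J = Finset.univ
  · simp [hJ]
  simp only [insertSign, Finset.sum_sub_distrib, Finset.sum_ite_eq, Finset.mem_compl]
  by_cases hr : (r : ZMod n) - 1 ∈ J
  · have := cyc_apply_of_mem hJ hr
    rw [this]
    push_cast
    simp [hr]
  · simp [hr, (cyc_apply_of_notMem hJ hr).2]

theorem sign_simpleReflection_sub (r : ℤ) (i : ZMod n) :
    Int.sign ((simpleReflection n i).1 r - r) =
      (if (r : ZMod n) = i then 1 else 0) - if (r : ZMod n) - 1 = i then 1 else 0 := by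
  rw [simpleReflection_apply]
  simp only [sub_eq_iff_eq_add]
  by_cases h1 : (r : ZMod n) = i
  · simp [h1]
  · simp only [h1, if_false]
    split_ifs <;> simp

/-- Here `cyc I` fixes the class of `i`, so the image of `r` is congruent to `i` only if `r` is. -/
theorem insertSign_of_start {I : Finset (ZMod n)} {i : ZMod n} (hi : i ∉ I) (hi' : i - 1 ∉ I)
    (r : ℤ) : insertSign r I i = Int.sign ((simpleReflection n i).1 r - r) := by
  rw [sign_simpleReflection_sub, insertSign]
  congr 2
  have hv : ((i.val : ℤ) : ZMod n) = i := by simp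
  have h := cyc_apply_self (x := i.val) (I := I) (by rwa [hv]) (by rwa [hv])
  have h2 := apply_modEq_iff (cyc I) r i.val
  rw [h, modEq_val_iff, modEq_val_iff] at h2
  exact propext h2

/-- The first indicator is unchanged because `cyc (insert i I) = cyc I * s_i`. The second could
change only for `r` congruent to `i` or `i + 1`, and then `r - 1` and `s_i r - 1` both lie in the
excluded classes `i - 1` and `i`. -/
theorem insertSign_insert {I : Finset (ZMod n)} {i j : ZMod n} (hi : i ∉ I) (hi' : i - 1 ∉ I)
    (hj : j ≠ i) (hj' : j ≠ i - 1) (r : ℤ) :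
    insertSign r (insert i I) j = insertSign ((simpleReflection n i).1 r) I j := by
  rw [insertSign, insertSign, cyc_insert hi hi']
  simp only [Subgroup.coe_mul, Equiv.Perm.mul_apply]
  congr 2
  rw [eq_iff_iff, simpleReflection_apply]
  split_ifs with h1 h2
  · subst h1
    push_cast
    rw [add_sub_cancel_right]
    exact ⟨fun h => absurd h.symm hj', fun h => absurd h.symm hj⟩
  · push_cast
    rw [h2, add_sub_cancel_right]
    exact ⟨fun h => absurd h.symm hj, fun h => absurd h.symm hj'⟩
  · rfl

/-- The Leibniz rule for multiplication by a cyclically decreasing element. -/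
theorem coverSum_nilMul_cyc (I : Finset (ZMod n)) (hI : I ≠ Finset.univ) (r : ℤ)
    (f : affineSymmetricGroup n → ℤ) :
    coverSum r (nilMul (cyc I) f) = nilMul (cyc I) (coverSum ((cyc I).1 r) f) +
      ∑ j ∈ I, insertSign r (I.erase j) j • nilMul (cyc (I.erase j)) f := by
  refine proper_induction (P := fun I => ∀ r : ℤ, coverSum r (nilMul (cyc I) f) =
    nilMul (cyc I) (coverSum ((cyc I).1 r) f) +
      ∑ j ∈ I, insertSign r (I.erase j) j • nilMul (cyc (I.erase j)) f) ?_ ?_ I hI r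
  · intro r
    have h1 : ∀ f : affineSymmetricGroup n → ℤ, nilMul 1 f = f := fun f => by
      ext w; simp [nilMul_apply, length_one]
    simp [cyc_empty, h1]
  · intro I i hi hi' ih r
    rw [cyc_insert hi hi', nilMul_mul_simpleReflection _ _ (length_cyc_mul hi hi'),
      nilMul_mul_simpleReflection _ _ (length_cyc_mul hi hi'),
      coverSum_nilMul_simpleReflection, ih, map_add, map_sum, Finset.sum_insert hi,
      Finset.erase_insert hi, insertSign_of_start hi hi', add_assoc]
    congr 1
    rw [add_comm]
    congr 1
    -- The term of the new letter was the scalar term of the Leibniz rule for `s_i`. The others come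
    -- from the inductive hypothesis at `s_i r`, and `i` still starts a run after `j` is erased.
    refine Finset.sum_congr rfl fun j hj => ?_
    have hji : j ≠ i := fun h => hi (h ▸ hj)
    have hji' : j ≠ i - 1 := fun h => hi' (h ▸ hj)
    have h1 : i ∉ I.erase j := fun h => hi (Finset.mem_of_mem_erase h)
    have h2 : i - 1 ∉ I.erase j := fun h => hi' (Finset.mem_of_mem_erase h)
    rw [Finset.erase_insert_of_ne hji.symm, insertSign_insert h1 h2 hji hji', cyc_insert h1 h2,
      nilMul_mul_simpleReflection _ _ (length_cyc_mul h1 h2), map_smul]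

/-- Multiplication by the sum of the cyclically decreasing elements of length `k`. -/
noncomputable def homMul (k : ℕ) (f : affineSymmetricGroup n → ℤ) : affineSymmetricGroup n → ℤ :=
  ∑ I : Finset (ZMod n) with I.card = k ∧ I ≠ Finset.univ, nilMul (cyc I) f

/-- Pairs `j ∈ I` are the same as pairs `j ∉ J` with `J = I \ {j}`; for fixed `J` the operator is
constant and its coefficients sum to zero. -/
theorem sum_sum_insertSign_erase (k : ℕ) (r : ℤ) (f : affineSymmetricGroup n → ℤ) :
    ∑ I : Finset (ZMod n) with I.card = k ∧ I ≠ Finset.univ,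
      ∑ j ∈ I, insertSign r (I.erase j) j • nilMul (cyc (I.erase j)) f = 0 := by
  have h1 : ∑ I : Finset (ZMod n) with I.card = k ∧ I ≠ Finset.univ,
      ∑ j ∈ I, insertSign r (I.erase j) j • nilMul (cyc (I.erase j)) f =
      ∑ I : Finset (ZMod n) with I.card = k,
      ∑ j ∈ I, insertSign r (I.erase j) j • nilMul (cyc (I.erase j)) f := by
    -- The full set may be added to the sum: the complement of `univ.erase j` is `{j}`, so the
    -- cancellation there says that the single coefficient is zero.
    rw [← Finset.filter_filter]
    refine Finset.sum_filter_of_ne fun I _ hne => ?_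
    rintro rfl
    apply hne
    refine Finset.sum_eq_zero fun j _ => ?_
    have := sum_insertSign r (Finset.univ.erase j)
    rw [Finset.compl_erase, Finset.compl_univ, insert_empty_eq, Finset.sum_singleton] at this
    rw [this, zero_smul]
  have h2 : ∑ I : Finset (ZMod n) with I.card = k,
      ∑ j ∈ I, insertSign r (I.erase j) j • nilMul (cyc (I.erase j)) f =
      ∑ J : Finset (ZMod n) with J.card + 1 = k,
      ∑ j ∈ Jᶜ, insertSign r J j • nilMul (cyc J) f := by
    rw [Finset.sum_sigma', Finset.sum_sigma']
    refine Finset.sum_bij' (fun p _ => ⟨p.1.erase p.2, p.2⟩) (fun p _ => ⟨insert p.2 p.1, p.2⟩)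
      ?_ ?_ ?_ ?_ ?_
    · rintro ⟨I, j⟩ h
      simp only [Finset.mem_sigma, Finset.mem_filter, Finset.mem_univ, true_and] at h ⊢
      simp [Finset.card_erase_add_one h.2, h.1]
    · rintro ⟨J, j⟩ h
      simp only [Finset.mem_sigma, Finset.mem_filter, Finset.mem_univ, true_and,
        Finset.mem_compl] at h ⊢
      simp [Finset.card_insert_of_notMem h.2, h.1]
    · rintro ⟨I, j⟩ h
      simp only [Finset.mem_sigma] at h
      simp [Finset.insert_erase h.2]
    · rintro ⟨J, j⟩ h
      simp only [Finset.mem_sigma, Finset.mem_compl] at h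
      simp [Finset.erase_insert h.2]
    · rintro ⟨I, j⟩ h
      rfl
  rw [h1, h2]
  refine Finset.sum_eq_zero fun J _ => ?_
  rw [← Finset.sum_smul, sum_insertSign, zero_smul]

/-- The Leibniz rule replaces `r` by its image under `cyc I`, so the kernel condition is needed for
all `r` at once. -/
theorem coverSum_homMul (k : ℕ) {f : affineSymmetricGroup n → ℤ} (hf : ∀ r, coverSum r f = 0)
    (r : ℤ) : coverSum r (homMul k f) = 0 := by
  rw [homMul, map_sum, ← sum_sum_insertSign_erase k r f]
  refine Finset.sum_congr rfl fun I hI => ?_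
  rw [coverSum_nilMul_cyc I (Finset.mem_filter.1 hI).2.2, hf, map_zero, zero_add]

end Vanishing

/-! ### Coefficients of affine Stanley functions as iterated products. -/

section Counting

variable {n : ℕ} [NeZero n] [Fact (1 < n)]

/-- The number of length-additive factorizations into `m` cyclically decreasing factors of lengths
`α 0, …, α (m - 1)`, as a function of the product. -/
noncomputable def factorCount (α : ℕ → ℕ) : ℕ → affineSymmetricGroup n → ℤ
  | 0 => fun w => if length w = 0 then 1 else 0
  | m + 1 => homMul (α m) (factorCount α m)

theorem coverSum_factorCount (α : ℕ → ℕ) (m : ℕ) (r : ℤ) :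
    coverSum r (factorCount (n := n) α m) = 0 := by
  induction m generalizing r with
  | zero =>
    ext v
    -- The starting function lives in length zero, and every cover has positive length.
    refine Finset.sum_eq_zero fun w hw => ?_
    have : length w = length v + 1 := by simpa using hw
    simp [factorCount, this]
  | succ m ih => exact coverSum_homMul _ ih r

open Classical in
/-- The factorizations counted by `factorCount`, extended by `1`. -/
noncomputable def factorizations (α : ℕ → ℕ) :
    ℕ → affineSymmetricGroup n → Finset (ℕ → affineSymmetricGroup n)
  | 0, w => if length w = 0 then {fun _ => 1} else ∅
  | m + 1, w => (Finset.univ.filter fun I : Finset (ZMod n) =>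
      I.card = α m ∧ I ≠ Finset.univ).biUnion fun I =>
        if length (w * (cyc I)⁻¹) + length (cyc I) = length w then
          (factorizations α m (w * (cyc I)⁻¹)).image fun f => Function.update f m (cyc I)
        else ∅

/-- The recursion demands additive lengths at every step, a decomposition only in total;
subadditivity makes these equivalent. -/
theorem mem_factorizations {α : ℕ → ℕ} {m : ℕ} {w : affineSymmetricGroup n}
    {f : ℕ → affineSymmetricGroup n} :
    f ∈ factorizations α m w ↔
      (∀ i < m, ∃ I : Finset (ZMod n), (I.card = α i ∧ I ≠ Finset.univ) ∧ cyc I = f i) ∧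
      (∀ i, m ≤ i → f i = 1) ∧ ((List.range m).map f).prod = w ∧
      ∑ i ∈ Finset.range m, α i = length w := by
  classical
  induction m generalizing w f with
  | zero =>
    simp only [factorizations]
    split_ifs with h
    · have hw := length_eq_zero_iff.1 h
      simp [hw, length_one, funext_iff]
    · simp [Ne.symm h]
  | succ m ih =>
    simp only [factorizations, Finset.mem_biUnion, Finset.mem_filter, Finset.mem_univ, true_and]
    constructor
    · rintro ⟨I, hI, hf⟩
      split_ifs at hf with hl
      · obtain ⟨g, hg, rfl⟩ := Finset.mem_image.1 hf
        obtain ⟨h1, h2, h3, h4⟩ := ih.1 hg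
        refine ⟨fun i hi => ?_, fun i hi => ?_, ?_, ?_⟩
        · rcases Nat.lt_succ_iff_lt_or_eq.1 hi with h | rfl
          · obtain ⟨J, hJ, hJg⟩ := h1 i h
            exact ⟨J, hJ, by rw [Function.update_of_ne h.ne, hJg]⟩
          · exact ⟨I, hI, by simp⟩
        · rw [Function.update_of_ne (by omega)]
          exact h2 i (by omega)
        · have e : (List.range m).map (Function.update g m (cyc I)) = (List.range m).map g :=
            List.map_congr_left fun i hi => Function.update_of_ne (List.mem_range.1 hi).ne _ _
          rw [List.range_succ, List.map_append, List.prod_append, e, h3]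
          simp
        · rw [Finset.sum_range_succ, h4, ← hl, length_cyc hI.2, hI.1]
      · simp at hf
    · rintro ⟨h1, h2, h3, h4⟩
      obtain ⟨I, hI, hIf⟩ := h1 m (by omega)
      refine ⟨I, hI, ?_⟩
      rw [List.range_succ, List.map_append, List.prod_append] at h3
      simp only [List.map_cons, List.map_nil, List.prod_cons, List.prod_nil, mul_one] at h3
      have hw : w * (cyc I)⁻¹ = ((List.range m).map f).prod := by rw [hIf, ← h3]; group
      rw [Finset.sum_range_succ] at h4
      -- An upper bound for prefixes; since the total equals the length of `w`, it is attained when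
      -- the last factor is split off.
      have hle : ∀ k ≤ m, length ((List.range k).map f).prod ≤ ∑ i ∈ Finset.range k, α i := by
        intro k hk
        induction k with
        | zero => simp [length_one]
        | succ k ihk =>
          rw [List.range_succ, List.map_append, List.prod_append, Finset.sum_range_succ]
          simp only [List.map_cons, List.map_nil, List.prod_cons, List.prod_nil, mul_one]
          obtain ⟨J, hJ, hJf⟩ := h1 k (by omega)
          have h5 := length_mul_le ((List.range k).map f).prod (f k)
          have h6 : length (f k) = α k := by rw [← hJf, length_cyc hJ.2, hJ.1]
          have := ihk (by omega)
          omega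
      have hlen := length_mul_le ((List.range m).map f).prod (f m)
      rw [h3, ← hIf, length_cyc hI.2, hI.1] at hlen
      have hlem := hle m le_rfl
      rw [if_pos (by rw [hw, length_cyc hI.2, hI.1]; omega), Finset.mem_image]
      refine ⟨Function.update f m 1, ih.2 ⟨fun i hi => ?_, fun i hi => ?_, ?_, ?_⟩, ?_⟩
      · rw [Function.update_of_ne hi.ne]
        exact h1 i (by omega)
      · rcases hi.eq_or_lt with rfl | hi
        · simp
        · rw [Function.update_of_ne hi.ne']
          exact h2 i hi
      · rw [hw]
        congr 1
        exact List.map_congr_left fun i hi => Function.update_of_ne (List.mem_range.1 hi).ne _ _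
      · rw [hw]; omega
      · rw [hIf]; simp

theorem card_factorizations (α : ℕ → ℕ) (m : ℕ) (w : affineSymmetricGroup n) :
    ((factorizations α m w).card : ℤ) = factorCount α m w := by
  classical
  induction m generalizing w with
  | zero =>
    simp only [factorizations, factorCount]
    split_ifs <;> simp
  | succ m ih =>
    rw [factorizations, Finset.card_biUnion]
    · rw [factorCount, homMul, Finset.sum_apply, Nat.cast_sum]
      refine Finset.sum_congr rfl fun I _ => ?_
      rw [nilMul_apply]
      split_ifs
      · rw [Finset.card_image_of_injOn, ih]
        intro f hf g hg hfg
        have h1 := (mem_factorizations.1 hf).2.1 m le_rfl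
        have h2 := (mem_factorizations.1 hg).2.1 m le_rfl
        ext1 i
        by_cases hi : i = m
        · rw [hi, h1, h2]
        · have := congrFun hfg i
          simpa [Function.update_of_ne hi] using this
      · simp
    · intro I hI J hJ hIJ
      have key : ∀ K : Finset (ZMod n), ∀ f ∈ (if length (w * (cyc K)⁻¹) + length (cyc K) =
          length w then (factorizations α m (w * (cyc K)⁻¹)).image
            fun f => Function.update f m (cyc K) else ∅), f m = cyc K := by
        intro K f hf
        split_ifs at hf
        · obtain ⟨g, -, rfl⟩ := Finset.mem_image.1 hf
          simp
        · simp at hf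
      rw [Function.onFun, Finset.disjoint_left]
      intro f hf hf'
      -- The last factor determines its set of letters, so different sets give disjoint families.
      exact hIJ (cyc_injOn (Finset.mem_filter.1 hI).2.2 (Finset.mem_filter.1 hJ).2.2
        ((key I f hf).symm.trans (key J f hf')))

theorem decompositions_eq (α : ℕ →₀ ℕ) {M : ℕ} (hM : ∀ i, M ≤ i → α i = 0)
    (w : affineSymmetricGroup n) : decompositions w α = factorizations α M w := by
  have hdeg : α.degree = ∑ i ∈ Finset.range M, α i := by
    rw [Finsupp.degree_apply]
    refine Finset.sum_subset (fun i hi => ?_) fun i _ hi => by simpa using hi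
    by_contra h
    exact Finsupp.mem_support_iff.1 hi (hM i (by simpa using h))
  -- The bound `N` in a decomposition is arbitrary, while `M` comes from `α`; the product does not
  -- depend on the cut-off.
  have hprod : ∀ (f : ℕ → affineSymmetricGroup n) (a b : ℕ), (∀ i, a ≤ i → f i = 1) → a ≤ b →
      ((List.range b).map f).prod = ((List.range a).map f).prod := by
    intro f a b hf hab
    induction b, hab using Nat.le_induction with
    | base => rfl
    | succ b hb ih => rw [List.range_succ, List.map_append, List.prod_append, ih]; simp [hf b hb]
  ext f
  rw [Finset.mem_coe, mem_factorizations]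
  constructor
  · rintro ⟨h1, h2, N, hN, hw⟩
    have hM1 : ∀ i, M ≤ i → f i = 1 := fun i hi =>
      length_eq_zero_iff.1 ((h2 i).2.trans (hM i hi))
    refine ⟨fun i _ => ?_, hM1, ?_, hdeg ▸ h1⟩
    · obtain ⟨I, hI, hIf⟩ := isCyclicallyDecreasing_iff.1 (h2 i).1
      exact ⟨I, ⟨by rw [← length_cyc hI, hIf, (h2 i).2], hI⟩, hIf⟩
    · rw [← hw, ← hprod f M (max M N) hM1 (le_max_left _ _),
        hprod f N (max M N) hN (le_max_right _ _)]
  · rintro ⟨h1, h2, h3, h4⟩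
    refine ⟨hdeg.trans h4, fun i => ?_, M, h2, h3⟩
    rcases lt_or_ge i M with hi | hi
    · obtain ⟨I, hI, hIf⟩ := h1 i hi
      exact ⟨isCyclicallyDecreasing_iff.2 ⟨I, hI.2, hIf⟩, by rw [← hIf, length_cyc hI.2, hI.1]⟩
    · rw [h2 i hi, hM i hi, length_one]
      exact ⟨isCyclicallyDecreasing_iff.2 ⟨∅, Finset.univ_nonempty.ne_empty.symm, cyc_empty⟩, rfl⟩

theorem coeff_affineStanley (α : ℕ →₀ ℕ) {M : ℕ} (hM : ∀ i, M ≤ i → α i = 0)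
    (w : affineSymmetricGroup n) : affineStanley w α = factorCount α M w := by
  rw [affineStanley, decompositions_eq α hM, Set.ncard_coe_finset, card_factorizations]

theorem finite_strongCover (v : affineSymmetricGroup n) : {w | StrongCover v w}.Finite :=
  (finite_length_eq (length v + 1)).subset fun _ h => h.2

end Counting

end AffineStanley

/-! ### The formula, coefficient by coefficient. -/

theorem theoremt (n : ℕ) (hn : 2 ≤ n) (r : ℤ) (v : AffineStanley.affineSymmetricGroup n) :
    (AffineStanley.leftCovers r v).Finite ∧ (AffineStanley.rightCovers r v).Finite ∧
      ∑ᶠ u ∈ AffineStanley.leftCovers r v, AffineStanley.affineStanley u =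
        ∑ᶠ w ∈ AffineStanley.rightCovers r v, AffineStanley.affineStanley w := by
  classical
  have : NeZero n := ⟨by omega⟩
  have : Fact (1 < n) := ⟨hn⟩
  have hL : (AffineStanley.leftCovers r v).Finite :=
    (AffineStanley.finite_strongCover v).subset fun _ h => h.1
  have hR : (AffineStanley.rightCovers r v).Finite :=
    (AffineStanley.finite_strongCover v).subset fun _ h => h.1
  refine ⟨hL, hR, ?_⟩
  rw [finsum_mem_eq_finite_toFinset_sum _ hL, finsum_mem_eq_finite_toFinset_sum _ hR]
  funext α
  obtain ⟨M, hM⟩ : ∃ M : ℕ, ∀ i, M ≤ i → α i = 0 := by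
    refine ⟨α.support.sup id + 1, fun i hi => ?_⟩
    by_contra h
    have : i ≤ α.support.sup id := Finset.le_sup (f := id) (Finsupp.mem_support_iff.2 h)
    omega
  have hcoeff : ∀ s : Finset (AffineStanley.affineSymmetricGroup n),
      (∑ u ∈ s, AffineStanley.affineStanley u) α =
        ∑ u ∈ s, AffineStanley.factorCount α M u := by
    intro s
    rw [← Finset.sum_congr rfl fun u _ => AffineStanley.coeff_affineStanley α hM u]
    exact Finset.sum_apply α s _
  rw [hcoeff, hcoeff, eq_comm, ← sub_eq_zero]
  -- Right sum minus left sum is the value at `v` of the cover operator on the coefficient function,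
  -- which vanishes.
  have h := congrFun (AffineStanley.coverSum_factorCount (n := n) α M r) v
  rw [Pi.zero_apply] at h
  rw [← h, AffineStanley.coverSum_apply,
    finsum_eq_sum_of_support_subset (s := hR.toFinset ∪ hL.toFinset)]
  · have hsign : ∀ w, AffineStanley.coverSign r v w =
        (if w ∈ AffineStanley.rightCovers r v then 1 else 0) -
          if w ∈ AffineStanley.leftCovers r v then 1 else 0 := by
      intro w
      simp only [AffineStanley.coverSign, AffineStanley.mem_rightCovers_iff,
        AffineStanley.mem_leftCovers_iff]
      by_cases hc : AffineStanley.StrongCover v w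
      · simp only [hc, true_and, if_true]
        rcases lt_trichotomy ((v⁻¹ * w).1 r) r with h | h | h
        · rw [Int.sign_eq_neg_one_of_neg (by omega), if_neg (by omega), if_pos h]; rfl
        · rw [h]; simp
        · rw [Int.sign_eq_one_of_pos (by omega), if_pos h, if_neg (by omega)]; rfl
      · simp [hc]
    simp only [hsign, sub_mul, Finset.sum_sub_distrib, ite_mul, one_mul, zero_mul]
    rw [← Finset.sum_filter, ← Finset.sum_filter]
    congr 1
    · congr 1
      ext w
      simp only [Set.Finite.mem_toFinset, Finset.mem_filter, Finset.mem_union]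
      tauto
    · congr 1
      ext w
      simp only [Set.Finite.mem_toFinset, Finset.mem_filter, Finset.mem_union]
      tauto
  · intro w hw
    have hne : AffineStanley.coverSign r v w ≠ 0 := left_ne_zero_of_mul hw
    rw [AffineStanley.coverSign] at hne
    split_ifs at hne with hc
    · simp only [Finset.coe_union, Set.Finite.coe_toFinset, Set.mem_union,
        AffineStanley.mem_rightCovers_iff, AffineStanley.mem_leftCovers_iff]
      rcases lt_trichotomy ((v⁻¹ * w).1 r) r with h | h | h
      · exact Or.inr ⟨hc, h⟩
      · rw [h, sub_self, Int.sign_zero] at hne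
        exact absurd rfl hne
      · exact Or.inl ⟨hc, h⟩
    · exact absurd rfl hne
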